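/- Let $\mathcal X_1,\mathcal X_2,\mathcal Y$ be finite alphabets, $P_{Y|X_1,X_2}$ a channel transition probability, $d_{min},d_{max}\ge 0$ integers, $\mathcal D=\{-d_{min},\dots,d_{max}\}$ and $D=d_{min}+d_{max}+1$. **The ACC-MAC.** For a delay $d\in\mathcal D$, blocks $\mathbf x_1\in\mathcal X_1^n$, $\mathbf x_2\in\mathcal X_2^n$ give the output $\mathbf y\in\mathcal Y^n$ with probability $P_d(\mathbf y|\mathbf x_1,\mathbf x_2)=\prod_{i=1}^n P_{Y|X_1,X_2}(y_i|x_{1,i-d},x_{2,i})$, where the symbols $x_{1,j}$ with $j\notin\{1,\dots,n\}$ are arbitrary elements of $\mathcal X_1$. A $(2^{nR_1},2^{nR_2},n)$-code has message sets $\mathcal M_k$ of size $\lceil 2^{nR_k}\rceil$ ($k=1,2$), encoders $f_1:\mathcal M_1\to\mathcal X_1^n$ and $f_2:\mathcal X_1^n\times\mathcal M_2\to\mathcal X_2^n$, and a decoder $g:\mathcal Y^n\to\mathcal M_1\times\mathcal M_2$ (which does not know $d$). Its average error probability under the delay $d$ is $$\bar P_{e,d}=\frac1{|\mathcal M_1||\mathcal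 M_2|}\sum_{m_1,m_2}\ \sum_{\mathbf y:\,g(\mathbf y)\ne(m_1,m_2)}P_d\bigl(\mathbf y\,|\,f_1(m_1),f_2(f_1(m_1),m_2)\bigr).$$ A pair $(R_1,R_2)$ with $R_1,R_2\ge0$ is achievable if there are $\epsilon_n\to0$ and, for each $n$, a $(2^{nR_1},2^{nR_2},n)$-code with $\bar P_{e,d}\le\epsilon_n$ for all $d\in\mathcal D$ and all choices of the symbols outside the block (which may depend on the messages). The capacity region is the closure of the set of achievable pairs; a set of rate pairs is an achievable rate region if it is contained in the capacity region. **Single-letter region.** For a distribution $P_{X_1}$ on $\mathcal X_1$ and a conditional distribution $P(x_2|\overline v)$ from $\mathcal X_1^D$ to $\mathcal X_2$, put, for $d\in\mathcal D$, $$P_d(x_1,\overline v,x_2,y)=\Bigl(\prod_{j=1}^D P_{X_1}(v_j)\Bigr)\mathbb 1_{\{x_1=v_{d_{max}-d+1}\}}\,P(x_2|\overline v)\,P_{Y|X_1,X_2}(y|x_1,x_2),$$ and let $I_d$ denote mutual information under $P_d$ and $H(X_1)$ the entropy of $P_{X_1}$, both in bits. Let $$\underline{\mathcal R}=\bigcup_{P_{X_1},\,P(x_2|\overline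 v)}\left\{(R_1,R_2)\in[0,\infty)^2:\ \begin{array}{l}R_1\le H(X_1),\\ R_2\le\min_{d\in\mathcal D}I_d(X_2;Y|\overline V),\\ R_1+R_2\le\min_{d\in\mathcal D}\bigl[I_d(X_1;Y)+I_d(X_2;Y|\overline V)\bigr]\end{array}\right\}.$$ **Theorem.** The closed convex hull of $\underline{\mathcal R}$ is an achievable rate region for the ACC-MAC, that is, it is contained in its capacity region. -/

import Mathlib

namespace ACCMAC

section Information

variable {α β γ : Type*} [Fintype α] [Fintype β] [Fintype γ]

/-- Shannon entropy, in bits, of a probability mass function on a finite alphabet. -/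
noncomputable def entropy (p : α → ℝ) : ℝ :=
  -∑ a, p a * Real.logb 2 (p a)

/-- Mutual information `I(A;B)`, in bits, of a joint probability mass function
`p a b = P(A = a, B = b)`. Terms with `p a b = 0` contribute `0`. -/
noncomputable def mutualInfo (p : α → β → ℝ) : ℝ :=
  ∑ a, ∑ b, p a b * Real.logb 2 (p a b / ((∑ b', p a b') * (∑ a', p a' b)))

/-- Conditional mutual information `I(A;B|C)`, in bits, of a joint probability mass function
`p a b c = P(A = a, B = b, C = c)`, i.e. the expectation of
`log (P(a,b,c) P(c) / (P(a,c) P(b,c)))`. Terms with `p a b c = 0` contribute `0`. -/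
noncomputable def condMutualInfo (p : α → β → γ → ℝ) : ℝ :=
  ∑ a, ∑ b, ∑ c, p a b c *
    Real.logb 2 ((p a b c * ∑ a', ∑ b', p a' b' c) / ((∑ b', p a b' c) * (∑ a', p a' b c)))

end Information

/-- The set of possible delays `{-dmin, -dmin + 1, …, dmax}`. -/
abbrev Delay (dmin dmax : ℕ) : Type :=
  {d : ℤ // -(dmin : ℤ) ≤ d ∧ d ≤ (dmax : ℤ)}

/-- The coordinate of the window `(V_1, …, V_D)`, `D = dmin + dmax + 1`, that the channel sees
under delay `d`. It is `dmax - d + 1` when counting from `1`, so `dmax - d` when counting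
from `0`. -/
def Delay.slot {dmin dmax : ℕ} (d : Delay dmin dmax) : Fin (dmin + dmax + 1) :=
  ⟨((dmax : ℤ) - d.1).toNat, by have h := d.2; omega⟩

section SingleLetter

variable {X₁ X₂ Y : Type*} [Fintype X₁] [Fintype X₂] [Fintype Y] {dmin dmax : ℕ}

open Classical in
/-- The joint probability mass function
`P_d(x₁, v, x₂, y) = (∏ j, P(v_j)) 1{x₁ = v_{dmax-d+1}} K(x₂|v) W(y|x₁,x₂)`. -/
noncomputable def jointPMF (W : X₁ → X₂ → Y → ℝ) (P : X₁ → ℝ)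
    (K : (Fin (dmin + dmax + 1) → X₁) → X₂ → ℝ) (d : Delay dmin dmax)
    (x₁ : X₁) (v : Fin (dmin + dmax + 1) → X₁) (x₂ : X₂) (y : Y) : ℝ :=
  (∏ j, P (v j)) * (if x₁ = v d.slot then 1 else 0) * K v x₂ * W x₁ x₂ y

/-- `I_d(X₁;Y)`. -/
noncomputable def infoX₁Y (W : X₁ → X₂ → Y → ℝ) (P : X₁ → ℝ)
    (K : (Fin (dmin + dmax + 1) → X₁) → X₂ → ℝ) (d : Delay dmin dmax) : ℝ :=
  mutualInfo fun (x₁ : X₁) (y : Y) => ∑ v, ∑ x₂, jointPMF W P K d x₁ v x₂ y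

/-- `I_d(X₂;Y|V)`, conditioned on the whole window `V = (V_1, …, V_D)`. -/
noncomputable def infoX₂YGivenV (W : X₁ → X₂ → Y → ℝ) (P : X₁ → ℝ)
    (K : (Fin (dmin + dmax + 1) → X₁) → X₂ → ℝ) (d : Delay dmin dmax) : ℝ :=
  condMutualInfo fun (x₂ : X₂) (y : Y) (v : Fin (dmin + dmax + 1) → X₁) =>
    ∑ x₁, jointPMF W P K d x₁ v x₂ y

/-- The single-letter region: the union over all input laws `P` on `X₁` and all conditional laws
`K` from windows to `X₂` of the sets of pairs of (nonnegative) rates that satisfy the three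
bounds. The bounds by a minimum over the finite set of delays are written out as bounds that
hold for every delay. -/
def innerRegion (dmin dmax : ℕ) (W : X₁ → X₂ → Y → ℝ) : Set (ℝ × ℝ) :=
  {R | 0 ≤ R.1 ∧ 0 ≤ R.2 ∧
    ∃ P ∈ stdSimplex ℝ X₁, ∃ K : (Fin (dmin + dmax + 1) → X₁) → X₂ → ℝ,
      (∀ v, K v ∈ stdSimplex ℝ X₂) ∧
      R.1 ≤ entropy P ∧
      (∀ d : Delay dmin dmax, R.2 ≤ infoX₂YGivenV W P K d) ∧
      (∀ d : Delay dmin dmax, R.1 + R.2 ≤ infoX₁Y W P K d + infoX₂YGivenV W P K d)}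

end SingleLetter

section Coding

variable {X₁ X₂ Y : Type*} [Fintype X₁] [Fintype X₂] [Fintype Y] {dmin dmax : ℕ}

/-- The symbol of user 1 that enters the channel at time `i` under delay `d`, namely the entry of
the codeword `x` at time `i - d`. If `i - d` is outside the transmission block, it is the
symbol `fill (i - d)`. -/
def delayed {n : ℕ} (x : Fin n → X₁) (fill : ℤ → X₁) (d : ℤ) (i : Fin n) : X₁ :=
  if h : 0 ≤ (i : ℤ) - d ∧ (i : ℤ) - d < n then
    x ⟨((i : ℤ) - d).toNat, by omega⟩
  else fill ((i : ℤ) - d)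

/-- The probability `P_d(y|x₁,x₂)` of the output block `y` when the blocks `x₁`, `x₂` are sent
through the memoryless channel `W` and user 1 suffers the delay `d`. -/
def blockProb (W : X₁ → X₂ → Y → ℝ) (d : ℤ) {n : ℕ} (fill : ℤ → X₁)
    (x₁ : Fin n → X₁) (x₂ : Fin n → X₂) (y : Fin n → Y) : ℝ :=
  ∏ i, W (delayed x₁ fill d i) (x₂ i) (y i)

variable (X₁ X₂ Y) in
/-- A block code of length `n` with `M₁` and `M₂` messages for the asynchronous codeword cognitive
multiple access channel: encoder 2 sees the codeword of user 1 but not its message, and the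
decoder sees the output block only, not the delay. -/
structure Code (M₁ M₂ n : ℕ) where
  enc₁ : Fin M₁ → (Fin n → X₁)
  enc₂ : (Fin n → X₁) → Fin M₂ → (Fin n → X₂)
  dec : (Fin n → Y) → Fin M₁ × Fin M₂

/-- The average probability of error under delay `d`, when the symbols of user 1 outside the
transmission block are given by `fill`; these may depend on the messages. -/
noncomputable def Code.errorProb {M₁ M₂ n : ℕ} (c : Code X₁ X₂ Y M₁ M₂ n)
    (W : X₁ → X₂ → Y → ℝ) (d : ℤ) (fill : Fin M₁ → Fin M₂ → ℤ → X₁) : ℝ :=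
  1 / ((M₁ : ℝ) * (M₂ : ℝ)) * ∑ m₁, ∑ m₂, ∑ y with c.dec y ≠ (m₁, m₂),
    blockProb W d (fill m₁ m₂) (c.enc₁ m₁) (c.enc₂ (c.enc₁ m₁) m₂) y

/-- The number of messages `2^{nR}`, rounded up to an integer. -/
noncomputable def numMessages (n : ℕ) (R : ℝ) : ℕ :=
  ⌈(2 : ℝ) ^ ((n : ℝ) * R)⌉₊

/-- Achievability of a rate pair: there are codes with these rates whose average probabilities of
error, for every delay and whatever the symbols outside the transmission block are, are at most
`ε n`, where `ε n → 0`. -/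
def Achievable (dmin dmax : ℕ) (W : X₁ → X₂ → Y → ℝ) (R : ℝ × ℝ) : Prop :=
  0 ≤ R.1 ∧ 0 ≤ R.2 ∧
    ∃ ε : ℕ → ℝ, Filter.Tendsto ε Filter.atTop (nhds 0) ∧
      ∀ n : ℕ, ∃ c : Code X₁ X₂ Y (numMessages n R.1) (numMessages n R.2) n,
        ∀ (d : Delay dmin dmax)
          (fill : Fin (numMessages n R.1) → Fin (numMessages n R.2) → ℤ → X₁),
          c.errorProb W d.1 fill ≤ ε n

/-- The capacity region: the closure of the set of achievable rate pairs. -/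
def capacityRegion (dmin dmax : ℕ) (W : X₁ → X₂ → Y → ℝ) : Set (ℝ × ℝ) :=
  closure {R | Achievable dmin dmax W R}

end Coding

end ACCMAC

set_option linter.unusedSectionVars false

/-! The proof is by random coding. The codeword of user 1 is i.i.d. with law `P`. Given that
codeword, each symbol of user 2 is drawn from `K` at the window of `dmin + dmax + 1` consecutive
symbols of user 1 that may meet it in the channel. The codebook law does not depend on the delay;
the delay only selects the slot of the window that the channel sees. The decoder does not estimate
the delay: it accepts a pair of messages that passes a likelihood-ratio test for some delay. The
number of delays is finite, so union bounds over them cost a constant factor.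

Four events cause errors. (a) The sent pair is atypical. The log-likelihoods are sums over
overlapping windows, and windows far apart are independent, so Chebyshev applies (`window_weak_law`,
`exists_atypical_bound`). (b) A wrong message of user 2 passes with the right codeword of user 1.
The ratio behind `I_d(X₂;Y|V)` has mean at most 1 under the independent law, so Markov gives the
bound on `R₂`. (c) A wrong codeword of user 1 passes. Averaging over user 2 first removes that
ratio. The remaining ratio involves one symbol per window, and these symbols are distinct entries of
an i.i.d. sequence, so the mean factorizes. Hence the sum bound contains `I_d(X₁;Y)`. (d) Two
messages of user 1 share a codeword. Encoder 2 sees only the codeword, so they cannot be told apart;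
this costs `R₁ ≤ H(X₁)`. The one-shot bound `exists_oneShot_code` combines the four events, and
`exists_interior_code` applies it to blocks.

A decoder that ignores the outputs near the ends never depends on symbols outside the block
(`hasCode_of_interior_code`). Codes robust in this sense can be concatenated, each block being an
arbitrary exterior for the other (`HasCode.append`); this is time sharing, and it gives convexity.
Trimming the message sets (`HasCode.shrink`) and scaling the rates down slightly yields achievable
pairs. The closure in the definition of the capacity region does the rest. -/

namespace ACCMAC

/-! ### Expectations under product laws -/

section PiSum

variable {ι κ α : Type*} [Fintype ι] [DecidableEq ι] [Fintype κ] [DecidableEq κ] [Fintype α]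

/-- The expectation of `F` when the coordinates are independent and coordinate `i` has the mass
function `p i`. -/
noncomputable def piSum (p : ι → α → ℝ) (F : (ι → α) → ℝ) : ℝ :=
  ∑ x : ι → α, (∏ i, p i (x i)) * F x

lemma piSum_add (p : ι → α → ℝ) (F G : (ι → α) → ℝ) :
    piSum p (fun x => F x + G x) = piSum p F + piSum p G := by
  simp [piSum, mul_add, Finset.sum_add_distrib]

lemma piSum_sum {γ : Type*} (s : Finset γ) (p : ι → α → ℝ) (F : γ → (ι → α) → ℝ) :
    piSum p (fun x => ∑ c ∈ s, F c x) = ∑ c ∈ s, piSum p (F c) := by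
  simp only [piSum, Finset.mul_sum]
  exact Finset.sum_comm

lemma piSum_mono {p : ι → α → ℝ} (hp : ∀ i a, 0 ≤ p i a) {F G : (ι → α) → ℝ}
    (h : ∀ x, F x ≤ G x) : piSum p F ≤ piSum p G :=
  Finset.sum_le_sum fun x _ =>
    mul_le_mul_of_nonneg_left (h x) (Finset.prod_nonneg fun i _ => hp i (x i))

lemma piSum_prod (p g : ι → α → ℝ) :
    piSum p (fun x => ∏ i, g i (x i)) = ∏ i, ∑ a, p i a * g i a := by
  simp only [piSum, ← Finset.prod_mul_distrib]
  rw [Finset.prod_univ_sum, Fintype.piFinset_univ]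

lemma piSum_const {p : ι → α → ℝ} (hp : ∀ i, ∑ a, p i a = 1) (r : ℝ) :
    piSum p (fun _ => r) = r := by
  have h := piSum_prod p (fun _ _ => 1)
  simp only [Finset.prod_const_one, mul_one, hp] at h
  have h2 : piSum p (fun _ => r) = piSum p (fun _ => 1) * r := by
    simp [piSum, Finset.sum_mul]
  rw [h2, h, one_mul]

lemma piSum_le {p : ι → α → ℝ} (hp : ∀ i, p i ∈ stdSimplex ℝ α) {F : (ι → α) → ℝ} {r : ℝ}
    (h : ∀ x, F x ≤ r) : piSum p F ≤ r :=
  (piSum_mono (fun i => (hp i).1) h).trans_eq (piSum_const (fun i => (hp i).2) r)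

/-- Marginalization: a fibre of `x ↦ x ∘ σ` is a box, with the coordinates in the range of `σ`
pinned and the others free, so its weight factors and the free coordinates sum to one. -/
lemma piSum_comp_injective {p : ι → α → ℝ} (hp : ∀ i, ∑ a, p i a = 1) {σ : κ → ι}
    (hσ : Function.Injective σ) (F : (κ → α) → ℝ) :
    piSum p (fun x => F (x ∘ σ)) = piSum (fun k => p (σ k)) F := by
  classical
  unfold piSum
  rw [← Finset.sum_fiberwise Finset.univ (fun x : ι → α => x ∘ σ)]
  refine Finset.sum_congr rfl fun v _ => ?_
  have h1 : ∀ x ∈ Finset.univ.filter (fun x : ι → α => x ∘ σ = v),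
      (∏ i, p i (x i)) * F (x ∘ σ) = (∏ i, p i (x i)) * F v := by
    intro x hx
    rw [(Finset.mem_filter.1 hx).2]
  rw [Finset.sum_congr rfl h1, ← Finset.sum_mul]
  congr 1
  have h2 : Finset.univ.filter (fun x : ι → α => x ∘ σ = v) =
      Fintype.piFinset (fun i => Finset.univ.filter (fun a => ∀ k, σ k = i → a = v k)) := by
    ext x
    simp only [Finset.mem_filter, Finset.mem_univ, true_and, Fintype.mem_piFinset]
    constructor
    · rintro h i k rfl
      exact congrFun h k
    · intro h
      funext k
      exact h (σ k) k rfl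
  rw [h2, ← Finset.prod_univ_sum]
  symm
  refine Fintype.prod_of_injective σ hσ _ _ (fun i hi => ?_) (fun k => ?_)
  · have : Finset.univ.filter (fun a => ∀ k, σ k = i → a = v k) = Finset.univ := by
      ext a
      simp only [Finset.mem_filter, Finset.mem_univ, true_and, iff_true]
      intro k hk
      exact absurd ⟨k, hk⟩ hi
    rw [this, hp]
  · have : Finset.univ.filter (fun a => ∀ k', σ k' = σ k → a = v k') = {v k} := by
      ext a
      simp only [Finset.mem_filter, Finset.mem_univ, true_and, Finset.mem_singleton]
      constructor
      · intro h
        exact h k rfl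
      · rintro rfl k' hk
        rw [hσ hk]
    rw [this, Finset.sum_singleton]

lemma piSum_single {p : ι → α → ℝ} (hp : ∀ i, ∑ a, p i a = 1) (i : ι) (φ : α → ℝ) :
    piSum p (fun x => φ (x i)) = ∑ a, p i a * φ a := by
  have h := piSum_comp_injective hp (σ := fun _ : Fin 1 => i)
    (Function.injective_of_subsingleton _) (fun v => φ (v 0))
  refine h.trans ?_
  unfold piSum
  refine Fintype.sum_equiv (Equiv.funUnique (Fin 1) α) _ _ fun v => ?_
  simp

lemma piSum_pair {p : ι → α → ℝ} (hp : ∀ i, ∑ a, p i a = 1) {i j : ι} (hij : i ≠ j)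
    (φ : α → α → ℝ) :
    piSum p (fun x => φ (x i) (x j)) = ∑ a, p i a * ∑ b, p j b * φ a b := by
  have hσ : Function.Injective ![i, j] := by
    intro a b hab
    fin_cases a <;> fin_cases b <;> simp_all [eq_comm]
  have h := piSum_comp_injective hp hσ (fun v => φ (v 0) (v 1))
  refine h.trans ?_
  simp only [piSum, Finset.mul_sum, ← Fintype.sum_prod_type']
  refine Fintype.sum_equiv (finTwoArrowEquiv α) _ _ fun v => ?_
  simp [Fin.prod_univ_two, mul_assoc]

lemma piSum_sumType (p : ι ⊕ κ → α → ℝ) (F : (ι → α) → ℝ) (G : (κ → α) → ℝ) :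
    piSum p (fun x => F (x ∘ Sum.inl) * G (x ∘ Sum.inr)) =
      piSum (fun i => p (Sum.inl i)) F * piSum (fun k => p (Sum.inr k)) G := by
  unfold piSum
  rw [Finset.sum_mul_sum, ← Fintype.sum_prod_type']
  refine Fintype.sum_equiv (Equiv.sumArrowEquivProdArrow ι κ α) _ _ fun v => ?_
  simp only [Fintype.prod_sum_type, Equiv.sumArrowEquivProdArrow, Equiv.coe_fn_mk,
    Function.comp_apply]
  ring

/-- The step from a random code to a fixed one: if `F` exceeded its mean everywhere, all weights
would vanish. -/
lemma exists_le_piSum {p : ι → α → ℝ} (hp : ∀ i, p i ∈ stdSimplex ℝ α) (F : (ι → α) → ℝ) :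
    ∃ x, F x ≤ piSum p F := by
  by_contra! h
  have h0 : ∀ x : ι → α, 0 ≤ ∏ i, p i (x i) := fun x => Finset.prod_nonneg fun i _ => (hp i).1 (x i)
  have hc := piSum_const (fun i => (hp i).2) (piSum p F)
  have h1 : ∑ x : ι → α, (∏ i, p i (x i)) * (F x - piSum p F) = 0 := by
    simp only [mul_sub, Finset.sum_sub_distrib]
    rw [sub_eq_zero]
    exact hc.symm
  rw [Finset.sum_eq_zero_iff_of_nonneg
    (fun x _ => mul_nonneg (h0 x) (sub_nonneg.2 (h x).le))] at h1
  have h2 : piSum p (fun _ => (1 : ℝ)) = 0 := by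
    refine Finset.sum_eq_zero fun x hx => ?_
    rcases mul_eq_zero.1 (h1 x hx) with h3 | h3
    · rw [h3, zero_mul]
    · exact absurd h3 (sub_pos.2 (h x)).ne'
  rw [piSum_const (fun i => (hp i).2)] at h2
  exact one_ne_zero h2

end PiSum

/-! ### Real-valued indicators -/

section Indicator

open Classical in
/-- The indicator of a proposition, as a real number. -/
noncomputable def ind (a : Prop) : ℝ := if a then 1 else 0

lemma ind_nonneg (a : Prop) : 0 ≤ ind a := by
  unfold ind; split_ifs <;> norm_num

lemma ind_le_one (a : Prop) : ind a ≤ 1 := by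
  unfold ind; split_ifs <;> norm_num

lemma ind_of_true {a : Prop} (h : a) : ind a = 1 := if_pos h

lemma ind_of_false {a : Prop} (h : ¬a) : ind a = 0 := if_neg h

lemma ind_mono {a b : Prop} (h : a → b) : ind a ≤ ind b := by
  by_cases ha : a
  · rw [ind_of_true ha, ind_of_true (h ha)]
  · rw [ind_of_false ha]; exact ind_nonneg b

end Indicator

/-! ### Random codebooks and the error events of the threshold decoder -/

section OneShot

variable {U S T Δ : Type*}

/-- The decoder returns some message pair whose codewords pass the test. It errs only if the sent
pair fails the test, the codeword of user 1 is too likely or used twice, or a wrong pair passes. -/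
lemma exists_decoder (π : U → ℝ) (τ : ℝ) (Pass : U → S → T → Prop) {M₁ M₂ : ℕ}
    (hM₁ : 0 < M₁) (hM₂ : 0 < M₂) (C₁ : Fin M₁ → U) (C₂ : U → Fin M₂ → S) :
    ∃ dec : T → Fin M₁ × Fin M₂, ∀ t m₁ m₂,
      ind (dec t ≠ (m₁, m₂)) ≤
        ind (¬ (Pass (C₁ m₁) (C₂ (C₁ m₁) m₂) t ∧ π (C₁ m₁) ≤ τ)) +
        ∑ m₂' ∈ Finset.univ.erase m₂, ind (Pass (C₁ m₁) (C₂ (C₁ m₁) m₂') t) +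
        ∑ m₁' ∈ Finset.univ.erase m₁, ind (C₁ m₁' = C₁ m₁ ∧ π (C₁ m₁) ≤ τ) +
        ∑ m₁' ∈ Finset.univ.erase m₁, ∑ m₂',
          ind (C₁ m₁ ≠ C₁ m₁' ∧ Pass (C₁ m₁') (C₂ (C₁ m₁') m₂') t) := by
  classical
  have hex : ∀ t, ∃ m : Fin M₁ × Fin M₂,
      (∃ m' : Fin M₁ × Fin M₂, Pass (C₁ m'.1) (C₂ (C₁ m'.1) m'.2) t) →
        Pass (C₁ m.1) (C₂ (C₁ m.1) m.2) t := by
    intro t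
    by_cases h : ∃ m' : Fin M₁ × Fin M₂, Pass (C₁ m'.1) (C₂ (C₁ m'.1) m'.2) t
    · obtain ⟨m, hm⟩ := h
      exact ⟨m, fun _ => hm⟩
    -- Default output when no pair passes; then the sent pair fails the test, and the error is
    -- already counted.
    · exact ⟨(⟨0, hM₁⟩, ⟨0, hM₂⟩), fun h' => absurd h' h⟩
  choose dec hdec using hex
  refine ⟨dec, fun t m₁ m₂ => ?_⟩
  have n1 := ind_nonneg (¬ (Pass (C₁ m₁) (C₂ (C₁ m₁) m₂) t ∧ π (C₁ m₁) ≤ τ))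
  have n2 : 0 ≤ ∑ m₂' ∈ Finset.univ.erase m₂, ind (Pass (C₁ m₁) (C₂ (C₁ m₁) m₂') t) :=
    Finset.sum_nonneg fun _ _ => ind_nonneg _
  have n3 : 0 ≤ ∑ m₁' ∈ Finset.univ.erase m₁, ind (C₁ m₁' = C₁ m₁ ∧ π (C₁ m₁) ≤ τ) :=
    Finset.sum_nonneg fun _ _ => ind_nonneg _
  have n4 : 0 ≤ ∑ m₁' ∈ Finset.univ.erase m₁, ∑ m₂',
      ind (C₁ m₁ ≠ C₁ m₁' ∧ Pass (C₁ m₁') (C₂ (C₁ m₁') m₂') t) :=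
    Finset.sum_nonneg fun _ _ => Finset.sum_nonneg fun _ _ => ind_nonneg _
  by_cases hp : Pass (C₁ m₁) (C₂ (C₁ m₁) m₂) t ∧ π (C₁ m₁) ≤ τ
  swap
  · have := ind_le_one (dec t ≠ (m₁, m₂))
    rw [ind_of_true hp]
    linarith
  by_cases he : dec t = (m₁, m₂)
  · rw [ind_of_false (not_not.2 he)]
    linarith
  have hd := hdec t ⟨(m₁, m₂), hp.1⟩
  have l1 := ind_le_one (dec t ≠ (m₁, m₂))
  by_cases h1 : (dec t).1 = m₁
  · have h2 : (dec t).2 ≠ m₂ := fun h2 => he (Prod.ext h1 h2)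
    have := Finset.single_le_sum (f := fun m₂' => ind (Pass (C₁ m₁) (C₂ (C₁ m₁) m₂') t))
      (fun _ _ => ind_nonneg _) (Finset.mem_erase.2 ⟨h2, Finset.mem_univ _⟩)
    rw [h1] at hd
    simp only [ind_of_true hd] at this
    linarith
  -- Equal codewords of user 1 give the same list of codewords of user 2, so this case has no
  -- independence to exploit and is charged to the collision term.
  · by_cases h3 : C₁ (dec t).1 = C₁ m₁
    · have := Finset.single_le_sum (f := fun m₁' => ind (C₁ m₁' = C₁ m₁ ∧ π (C₁ m₁) ≤ τ))
        (fun _ _ => ind_nonneg _) (Finset.mem_erase.2 ⟨h1, Finset.mem_univ _⟩)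
      rw [ind_of_true ⟨h3, hp.2⟩] at this
      linarith
    · have h4 := Finset.single_le_sum (f := fun m₁' => ∑ m₂',
          ind (C₁ m₁ ≠ C₁ m₁' ∧ Pass (C₁ m₁') (C₂ (C₁ m₁') m₂') t))
        (fun _ _ => Finset.sum_nonneg fun _ _ => ind_nonneg _)
        (Finset.mem_erase.2 ⟨h1, Finset.mem_univ _⟩)
      have h5 := Finset.single_le_sum (f := fun m₂' =>
          ind (C₁ m₁ ≠ C₁ (dec t).1 ∧ Pass (C₁ (dec t).1) (C₂ (C₁ (dec t).1) m₂') t))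
        (fun _ _ => ind_nonneg _) (Finset.mem_univ (dec t).2)
      rw [ind_of_true ⟨fun h => h3 h.symm, hd⟩] at h5
      linarith

variable [Fintype U] [Fintype S] [Fintype T] [Fintype Δ] [DecidableEq U] {M₁ M₂ : ℕ}

/-- The expectation over a random codebook: the codewords of user 1 are independent with law `π`,
and for each codeword `u` of user 1 those of user 2 are independent with law `κ u`. -/
noncomputable def codebookMean (M₁ M₂ : ℕ) (π : U → ℝ) (κ : U → S → ℝ)
    (F : (Fin M₁ → U) → (U → Fin M₂ → S) → ℝ) : ℝ :=
  piSum (fun _ : Fin M₁ => π) fun C₁ =>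
    piSum (fun k : U × Fin M₂ => κ k.1) fun C₂ => F C₁ fun u m => C₂ (u, m)

lemma codebookMean_add (π : U → ℝ) (κ : U → S → ℝ)
    (F G : (Fin M₁ → U) → (U → Fin M₂ → S) → ℝ) :
    codebookMean M₁ M₂ π κ (fun a b => F a b + G a b) =
      codebookMean M₁ M₂ π κ F + codebookMean M₁ M₂ π κ G := by
  simp only [codebookMean, piSum_add]

lemma codebookMean_sum {γ : Type*} (s : Finset γ) (π : U → ℝ) (κ : U → S → ℝ)
    (F : γ → (Fin M₁ → U) → (U → Fin M₂ → S) → ℝ) :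
    codebookMean M₁ M₂ π κ (fun a b => ∑ c ∈ s, F c a b) =
      ∑ c ∈ s, codebookMean M₁ M₂ π κ (F c) := by
  simp only [codebookMean, piSum_sum]

lemma exists_le_codebookMean {π : U → ℝ} {κ : U → S → ℝ} (hπ : π ∈ stdSimplex ℝ U)
    (hκ : ∀ u, κ u ∈ stdSimplex ℝ S) (F : (Fin M₁ → U) → (U → Fin M₂ → S) → ℝ) :
    ∃ a b, F a b ≤ codebookMean M₁ M₂ π κ F := by
  obtain ⟨a, ha⟩ := exists_le_piSum (fun _ : Fin M₁ => hπ) fun C₁ =>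
    piSum (fun k : U × Fin M₂ => κ k.1) fun C₂ => F C₁ fun u m => C₂ (u, m)
  obtain ⟨b, hb⟩ := exists_le_piSum (fun k : U × Fin M₂ => hκ k.1) fun C₂ =>
    F a fun u m => C₂ (u, m)
  exact ⟨a, _, hb.trans ha⟩

lemma sum_stdSimplex_mul_le {α : Type*} [Fintype α] {p : α → ℝ} (hp : p ∈ stdSimplex ℝ α)
    {f : α → ℝ} {r : ℝ} (h : ∀ a, f a ≤ r) : ∑ a, p a * f a ≤ r :=
  calc ∑ a, p a * f a ≤ ∑ a, p a * r :=
        Finset.sum_le_sum fun a _ => mul_le_mul_of_nonneg_left (h a) (hp.1 a)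
    _ = r := by rw [← Finset.sum_mul, hp.2, one_mul]

lemma codebookMean_sent {π : U → ℝ} {κ : U → S → ℝ} (hπ : π ∈ stdSimplex ℝ U)
    (hκ : ∀ u, κ u ∈ stdSimplex ℝ S) (m₁ : Fin M₁) (m₂ : Fin M₂) (F : U → S → ℝ) :
    codebookMean M₁ M₂ π κ (fun C₁ C₂ => F (C₁ m₁) (C₂ (C₁ m₁) m₂)) =
      ∑ u, π u * ∑ s, κ u s * F u s := by
  unfold codebookMean
  have h : ∀ C₁ : Fin M₁ → U, piSum (fun k : U × Fin M₂ => κ k.1)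
      (fun C₂ => F (C₁ m₁) (C₂ (C₁ m₁, m₂))) = ∑ s, κ (C₁ m₁) s * F (C₁ m₁) s := fun C₁ =>
    piSum_single (fun k : U × Fin M₂ => (hκ k.1).2) (C₁ m₁, m₂) (F (C₁ m₁))
  simp only [h]
  exact piSum_single (fun _ => hπ.2) m₁ (fun u => ∑ s, κ u s * F u s)

/-- Given the codeword of user 1, the competing codeword of user 2 is independent of the sent one,
hence of the output, and `hα` applies for each output. -/
lemma codebookMean_wrong_second {π : U → ℝ} {κ : U → S → ℝ} {ω : U → S → T → ℝ}
    {Pass : U → S → T → Prop} {α : ℝ} (hπ : π ∈ stdSimplex ℝ U)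
    (hκ : ∀ u, κ u ∈ stdSimplex ℝ S) (hω : ∀ u s, ω u s ∈ stdSimplex ℝ T)
    (hα : ∀ u t, ∑ s, κ u s * ind (Pass u s t) ≤ α)
    (m₁ : Fin M₁) {m₂ m₂' : Fin M₂} (hm : m₂' ≠ m₂) :
    codebookMean M₁ M₂ π κ (fun C₁ C₂ => ∑ t, ω (C₁ m₁) (C₂ (C₁ m₁) m₂) t *
      ind (Pass (C₁ m₁) (C₂ (C₁ m₁) m₂') t)) ≤ α := by
  refine piSum_le (fun _ => hπ) fun C₁ => ?_
  have h := piSum_pair (fun k : U × Fin M₂ => (hκ k.1).2) (i := (C₁ m₁, m₂)) (j := (C₁ m₁, m₂'))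
    (fun h => hm (Prod.ext_iff.1 h).2.symm)
    (fun s s' => ∑ t, ω (C₁ m₁) s t * ind (Pass (C₁ m₁) s' t))
  refine h.trans_le (sum_stdSimplex_mul_le (hκ _) fun s => ?_)
  simp only [Finset.mul_sum]
  rw [Finset.sum_comm]
  simp only [mul_left_comm _ (ω _ _ _), ← Finset.mul_sum]
  exact sum_stdSimplex_mul_le (hω _ _) fun t => hα _ t

/-- Given `C₁ m₁ = u`, the other codeword equals `u` with probability `π u`, and this is counted
only when `π u ≤ τ`. -/
lemma codebookMean_collision {π : U → ℝ} {κ : U → S → ℝ} {τ : ℝ} (hπ : π ∈ stdSimplex ℝ U)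
    (hκ : ∀ u, κ u ∈ stdSimplex ℝ S) (hτ : 0 ≤ τ) {m₁ m₁' : Fin M₁} (hm : m₁' ≠ m₁) :
    codebookMean M₁ M₂ π κ (fun C₁ _ => ind (C₁ m₁' = C₁ m₁ ∧ π (C₁ m₁) ≤ τ)) ≤ τ := by
  unfold codebookMean
  simp only [piSum_const (fun k : U × Fin M₂ => (hκ k.1).2)]
  refine (piSum_pair (fun _ => hπ.2) hm.symm (fun u u' => ind (u' = u ∧ π u ≤ τ))).trans_le
    (sum_stdSimplex_mul_le hπ fun u => ?_)
  rw [Finset.sum_eq_single u]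
  · by_cases h : π u ≤ τ
    · rw [ind_of_true ⟨rfl, h⟩, mul_one]
      exact h
    · rw [ind_of_false (fun h' => h h'.2), mul_zero]
      exact hτ
  · intro b _ hb
    rw [ind_of_false (fun h' => hb h'.1), mul_zero]
  · intro h
    exact absurd (Finset.mem_univ _) h

/-- Distinct codewords of user 1 index independent codewords of user 2. The inequality inside the
indicator secures this independence and is dropped once used. -/
lemma codebookMean_wrong_first {π : U → ℝ} {κ : U → S → ℝ} {ω : U → S → T → ℝ}
    {Pass : U → S → T → Prop} {β : ℝ} (hπ : π ∈ stdSimplex ℝ U)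
    (hκ : ∀ u, κ u ∈ stdSimplex ℝ S) (hω : ∀ u s, ω u s ∈ stdSimplex ℝ T)
    (hβ : ∀ t, ∑ u, π u * ∑ s, κ u s * ind (Pass u s t) ≤ β)
    {m₁ m₁' : Fin M₁} (hm : m₁' ≠ m₁) (m₂ m₂' : Fin M₂) :
    codebookMean M₁ M₂ π κ (fun C₁ C₂ => ∑ t, ω (C₁ m₁) (C₂ (C₁ m₁) m₂) t *
      ind (C₁ m₁ ≠ C₁ m₁' ∧ Pass (C₁ m₁') (C₂ (C₁ m₁') m₂') t)) ≤ β := by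
  have h1 : ∀ C₁ : Fin M₁ → U, piSum (fun k : U × Fin M₂ => κ k.1) (fun C₂ =>
      ∑ t, ω (C₁ m₁) (C₂ (C₁ m₁, m₂)) t *
        ind (C₁ m₁ ≠ C₁ m₁' ∧ Pass (C₁ m₁') (C₂ (C₁ m₁', m₂')) t)) ≤
      ∑ s, κ (C₁ m₁) s * ∑ s', κ (C₁ m₁') s' * ∑ t, ω (C₁ m₁) s t *
        ind (Pass (C₁ m₁') s' t) := by
    intro C₁
    by_cases hne : C₁ m₁ = C₁ m₁'
    · have : ∀ C₂ : U × Fin M₂ → S, ∑ t, ω (C₁ m₁) (C₂ (C₁ m₁, m₂)) t *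
          ind (C₁ m₁ ≠ C₁ m₁' ∧ Pass (C₁ m₁') (C₂ (C₁ m₁', m₂')) t) = 0 := fun C₂ =>
        Finset.sum_eq_zero fun t _ => by
          rw [ind_of_false (fun h => h.1 hne), mul_zero]
      simp only [this]
      rw [piSum_const (fun k : U × Fin M₂ => (hκ k.1).2)]
      exact Finset.sum_nonneg fun s _ => mul_nonneg ((hκ _).1 _) <|
        Finset.sum_nonneg fun s' _ => mul_nonneg ((hκ _).1 _) <|
        Finset.sum_nonneg fun t _ => mul_nonneg ((hω _ _).1 _) (ind_nonneg _)
    · refine (piSum_mono (fun k : U × Fin M₂ => (hκ k.1).1) fun C₂ => ?_).trans_eq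
        (piSum_pair (fun k : U × Fin M₂ => (hκ k.1).2) (i := (C₁ m₁, m₂)) (j := (C₁ m₁', m₂'))
          (fun h => hne (Prod.ext_iff.1 h).1)
          (fun s s' => ∑ t, ω (C₁ m₁) s t * ind (Pass (C₁ m₁') s' t)))
      exact Finset.sum_le_sum fun t _ =>
        mul_le_mul_of_nonneg_left (ind_mono fun h => h.2) ((hω _ _).1 _)
  refine (piSum_mono (fun _ => hπ.1) h1).trans ?_
  refine (piSum_pair (fun _ => hπ.2) hm.symm (fun u u' => ∑ s, κ u s * ∑ s', κ u' s' *
    ∑ t, ω u s t * ind (Pass u' s' t))).trans_le (sum_stdSimplex_mul_le hπ fun u => ?_)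
  have h2 : ∑ u', π u' * ∑ s, κ u s * ∑ s', κ u' s' * ∑ t, ω u s t * ind (Pass u' s' t) =
      ∑ s, κ u s * ∑ t, ω u s t * ∑ u', π u' * ∑ s', κ u' s' * ind (Pass u' s' t) := by
    have h3 : ∀ u' s, ∑ s', κ u' s' * ∑ t, ω u s t * ind (Pass u' s' t) =
        ∑ t, ω u s t * ∑ s', κ u' s' * ind (Pass u' s' t) := by
      intro u' s
      simp only [Finset.mul_sum]
      rw [Finset.sum_comm]
      simp only [mul_left_comm]
    simp only [h3]
    calc _ = ∑ u', ∑ s, ∑ t, κ u s * (ω u s t *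
            (π u' * ∑ s', κ u' s' * ind (Pass u' s' t))) := by
          refine Finset.sum_congr rfl fun u' _ => ?_
          rw [Finset.mul_sum]
          refine Finset.sum_congr rfl fun s _ => ?_
          rw [Finset.mul_sum, Finset.mul_sum]
          refine Finset.sum_congr rfl fun t _ => ?_
          ring
      _ = ∑ s, ∑ u', ∑ t, κ u s * (ω u s t *
            (π u' * ∑ s', κ u' s' * ind (Pass u' s' t))) := Finset.sum_comm
      _ = _ := by
          refine Finset.sum_congr rfl fun s _ => ?_
          rw [Finset.sum_comm]
          simp only [← Finset.mul_sum]
  rw [h2]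
  exact sum_stdSimplex_mul_le (hκ _) fun s => sum_stdSimplex_mul_le (hω _ _) fun t => hβ t

end OneShot

/-! ### The one-shot achievability bound -/

section OneShotCode

variable {U S T Δ : Type*} [Fintype U] [Fintype S] [Fintype T] [Fintype Δ] {M₁ M₂ : ℕ}

/-- The union bound of `exists_decoder` is averaged over the codebook after summing over message
pairs and delays, so one codebook serves every delay. -/
lemma exists_oneShot_code {π : U → ℝ} {κ : U → S → ℝ} {ω : Δ → U → S → T → ℝ}
    {Pass : U → S → T → Prop} {τ α β : ℝ} (hπ : π ∈ stdSimplex ℝ U)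
    (hκ : ∀ u, κ u ∈ stdSimplex ℝ S) (hω : ∀ d u s, ω d u s ∈ stdSimplex ℝ T) (hτ : 0 ≤ τ)
    (hα : ∀ u t, ∑ s, κ u s * ind (Pass u s t) ≤ α)
    (hβ : ∀ t, ∑ u, π u * ∑ s, κ u s * ind (Pass u s t) ≤ β)
    (hM₁ : 0 < M₁) (hM₂ : 0 < M₂) :
    ∃ (C₁ : Fin M₁ → U) (C₂ : U → Fin M₂ → S) (dec : T → Fin M₁ × Fin M₂),
      ∑ m₁, ∑ m₂, ∑ d, ∑ t, ω d (C₁ m₁) (C₂ (C₁ m₁) m₂) t * ind (dec t ≠ (m₁, m₂)) ≤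
        (M₁ : ℝ) * M₂ * (∑ d, ∑ u, π u * ∑ s, κ u s * ∑ t, ω d u s t *
            ind (¬ (Pass u s t ∧ π u ≤ τ)) +
          Fintype.card Δ * (((M₂ : ℝ) - 1) * α + ((M₁ : ℝ) - 1) * τ +
            ((M₁ : ℝ) - 1) * M₂ * β)) := by
  classical
  set bad : Fin M₁ → Fin M₂ → T → (Fin M₁ → U) → (U → Fin M₂ → S) → ℝ :=
    fun m₁ m₂ t C₁ C₂ => ind (¬ (Pass (C₁ m₁) (C₂ (C₁ m₁) m₂) t ∧ π (C₁ m₁) ≤ τ)) +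
        ∑ m₂' ∈ Finset.univ.erase m₂, ind (Pass (C₁ m₁) (C₂ (C₁ m₁) m₂') t) +
        ∑ m₁' ∈ Finset.univ.erase m₁, ind (C₁ m₁' = C₁ m₁ ∧ π (C₁ m₁) ≤ τ) +
        ∑ m₁' ∈ Finset.univ.erase m₁, ∑ m₂',
          ind (C₁ m₁ ≠ C₁ m₁' ∧ Pass (C₁ m₁') (C₂ (C₁ m₁') m₂') t) with hbad
  have key : ∀ m₁ m₂ d, codebookMean M₁ M₂ π κ (fun C₁ C₂ =>
      ∑ t, ω d (C₁ m₁) (C₂ (C₁ m₁) m₂) t * bad m₁ m₂ t C₁ C₂) ≤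
      ∑ u, π u * ∑ s, κ u s * ∑ t, ω d u s t * ind (¬ (Pass u s t ∧ π u ≤ τ)) +
        (((M₂ : ℝ) - 1) * α + ((M₁ : ℝ) - 1) * τ + ((M₁ : ℝ) - 1) * M₂ * β) := by
    intro m₁ m₂ d
    have hsplit : ∀ (C₁ : Fin M₁ → U) (C₂ : U → Fin M₂ → S),
        ∑ t, ω d (C₁ m₁) (C₂ (C₁ m₁) m₂) t * bad m₁ m₂ t C₁ C₂ =
        ∑ t, ω d (C₁ m₁) (C₂ (C₁ m₁) m₂) t *
          ind (¬ (Pass (C₁ m₁) (C₂ (C₁ m₁) m₂) t ∧ π (C₁ m₁) ≤ τ)) +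
        ∑ m₂' ∈ Finset.univ.erase m₂, ∑ t, ω d (C₁ m₁) (C₂ (C₁ m₁) m₂) t *
          ind (Pass (C₁ m₁) (C₂ (C₁ m₁) m₂') t) +
        ∑ m₁' ∈ Finset.univ.erase m₁, ind (C₁ m₁' = C₁ m₁ ∧ π (C₁ m₁) ≤ τ) +
        ∑ m₁' ∈ Finset.univ.erase m₁, ∑ m₂', ∑ t, ω d (C₁ m₁) (C₂ (C₁ m₁) m₂) t *
          ind (C₁ m₁ ≠ C₁ m₁' ∧ Pass (C₁ m₁') (C₂ (C₁ m₁') m₂') t) := by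
      intro C₁ C₂
      simp only [hbad, mul_add, Finset.sum_add_distrib]
      congr 1
      · congr 1
        · congr 1
          rw [Finset.sum_comm]
          simp only [Finset.mul_sum]
        · rw [← Finset.sum_mul, (hω _ _ _).2, one_mul]
      · simp only [Finset.mul_sum]
        rw [Finset.sum_comm]
        exact Finset.sum_congr rfl fun _ _ => Finset.sum_comm
    simp only [hsplit, codebookMean_add, codebookMean_sum]
    have e1 : ((Finset.univ.erase m₁).card : ℝ) = (M₁ : ℝ) - 1 := by
      rw [Finset.card_erase_of_mem (Finset.mem_univ _), Finset.card_univ, Fintype.card_fin,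
        Nat.cast_sub hM₁, Nat.cast_one]
    have e2 : ((Finset.univ.erase m₂).card : ℝ) = (M₂ : ℝ) - 1 := by
      rw [Finset.card_erase_of_mem (Finset.mem_univ _), Finset.card_univ, Fintype.card_fin,
        Nat.cast_sub hM₂, Nat.cast_one]
    have b1 := codebookMean_sent (M₁ := M₁) (M₂ := M₂) hπ hκ m₁ m₂ (fun u s => ∑ t, ω d u s t *
      ind (¬ (Pass u s t ∧ π u ≤ τ)))
    have b2 := Finset.sum_le_card_nsmul (Finset.univ.erase m₂) _ α fun m₂' hm =>
      codebookMean_wrong_second (M₁ := M₁) hπ hκ (hω d) hα m₁ (Finset.ne_of_mem_erase hm)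
    have b3 := Finset.sum_le_card_nsmul (Finset.univ.erase m₁) _ τ fun m₁' hm =>
      codebookMean_collision (M₂ := M₂) hπ hκ hτ (Finset.ne_of_mem_erase hm)
    have b4 := Finset.sum_le_card_nsmul (Finset.univ.erase m₁) _ (M₂ * β) fun m₁' hm =>
      (Finset.sum_le_card_nsmul Finset.univ _ β fun m₂' _ =>
        codebookMean_wrong_first (M₂ := M₂) hπ hκ (hω d) hβ
          (Finset.ne_of_mem_erase hm) m₂ m₂').trans_eq (by simp)
    rw [nsmul_eq_mul, e2] at b2
    rw [nsmul_eq_mul, e1] at b3 b4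
    simp only [codebookMean_sum] at b1 b2 b3 b4
    linarith
  have tot : codebookMean M₁ M₂ π κ (fun C₁ C₂ => ∑ m₁, ∑ m₂, ∑ d,
      ∑ t, ω d (C₁ m₁) (C₂ (C₁ m₁) m₂) t * bad m₁ m₂ t C₁ C₂) ≤
      (M₁ : ℝ) * M₂ * (∑ d, ∑ u, π u * ∑ s, κ u s * ∑ t, ω d u s t *
            ind (¬ (Pass u s t ∧ π u ≤ τ)) +
          Fintype.card Δ * (((M₂ : ℝ) - 1) * α + ((M₁ : ℝ) - 1) * τ +
            ((M₁ : ℝ) - 1) * M₂ * β)) := by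
    simp only [codebookMean_sum] at key ⊢
    refine (Finset.sum_le_sum fun m₁ _ => Finset.sum_le_sum fun m₂ _ =>
      Finset.sum_le_sum fun d _ => key m₁ m₂ d).trans_eq ?_
    simp only [Finset.sum_add_distrib, Finset.sum_const, Finset.card_univ, Fintype.card_fin,
      nsmul_eq_mul]
    ring
  obtain ⟨C₁, C₂, hC⟩ := exists_le_codebookMean (M₁ := M₁) (M₂ := M₂) hπ hκ
    (fun C₁ C₂ => ∑ m₁, ∑ m₂, ∑ d,
      ∑ t, ω d (C₁ m₁) (C₂ (C₁ m₁) m₂) t * bad m₁ m₂ t C₁ C₂)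
  obtain ⟨dec, hdec⟩ := exists_decoder π τ Pass hM₁ hM₂ C₁ C₂
  refine ⟨C₁, C₂, dec, le_trans ?_ (hC.trans tot)⟩
  exact Finset.sum_le_sum fun m₁ _ => Finset.sum_le_sum fun m₂ _ => Finset.sum_le_sum fun d _ =>
    Finset.sum_le_sum fun t _ => mul_le_mul_of_nonneg_left (hdec t m₁ m₂) ((hω _ _ _).1 _)

end OneShotCode

/-! ### Weak law of large numbers for sliding windows -/

section Window

variable {A Z : Type*} [Fintype A] [Fintype Z] {N c : ℕ}

/-- The window of `c + 1` consecutive entries of `x` that starts at position `i`. -/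
def window (x : Fin (N + c) → A) (i : Fin N) : Fin (c + 1) → A :=
  fun j => x ⟨i + j, by omega⟩

lemma piSum_window {P : A → ℝ} (hP : P ∈ stdSimplex ℝ A) (i : Fin N)
    (G : (Fin (c + 1) → A) → ℝ) :
    piSum (fun _ : Fin (N + c) => P) (fun x => G (window x i)) = piSum (fun _ => P) G := by
  have hσ : Function.Injective (fun j : Fin (c + 1) => (⟨i + j, by omega⟩ : Fin (N + c))) := by
    intro a b h
    simp only [Fin.mk.injEq] at h
    exact Fin.ext (by omega)
  exact piSum_comp_injective (fun _ => hP.2) hσ G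

lemma piSum_window_mul_window {P : A → ℝ} (hP : P ∈ stdSimplex ℝ A) {i k : Fin N}
    (h : (i : ℕ) + c < k) (G H : (Fin (c + 1) → A) → ℝ) :
    piSum (fun _ : Fin (N + c) => P) (fun x => G (window x i) * H (window x k)) =
      piSum (fun _ => P) G * piSum (fun _ => P) H := by
  have hσ : Function.Injective (Sum.elim
      (fun j : Fin (c + 1) => (⟨i + j, by omega⟩ : Fin (N + c)))
      (fun j : Fin (c + 1) => (⟨k + j, by omega⟩ : Fin (N + c)))) := by
    rintro (a | a) (b | b) hab <;> simp only [Sum.elim_inl, Sum.elim_inr, Fin.mk.injEq] at hab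
    · exact congrArg _ (Fin.ext (by omega))
    · omega
    · omega
    · exact congrArg _ (Fin.ext (by omega))
  exact (piSum_comp_injective (fun _ => hP.2) hσ
    (fun w => G (w ∘ Sum.inl) * H (w ∘ Sum.inr))).trans (piSum_sumType _ G H)

lemma card_close_le (i : Fin N) (c : ℕ) :
    ((Finset.univ.filter fun k : Fin N => ¬ ((i : ℕ) + c < k ∨ (k : ℕ) + c < i)).card : ℝ) ≤
      2 * c + 1 := by
  have h : (Finset.univ.filter fun k : Fin N => ¬ ((i : ℕ) + c < k ∨ (k : ℕ) + c < i)).card ≤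
      (Finset.Icc ((i : ℤ) - c) (i + c)).card := by
    refine Finset.card_le_card_of_injOn (fun k => ((k : ℕ) : ℤ)) (fun k hk => ?_)
      (fun a _ b _ hab => ?_)
    · simp only [Finset.coe_filter, Finset.mem_univ, true_and, Set.mem_ofPred_eq] at hk
      simp only [Finset.coe_Icc, Set.mem_Icc]
      omega
    · simp only at hab
      exact Fin.ext (by exact_mod_cast hab)
  rw [Int.card_Icc] at h
  have h2 : ((i : ℤ) + c + 1 - (i - c)).toNat = 2 * c + 1 := by omega
  rw [h2] at h
  exact_mod_cast h

/-- Given `x` the outputs are independent, so the mean is that of a product of functions of two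
windows; these are disjoint, hence independent, and each factor is centred. -/
lemma window_covariance {P : A → ℝ} (hP : P ∈ stdSimplex ℝ A)
    {Q : (Fin (c + 1) → A) → Z → ℝ} (hQ : ∀ v, Q v ∈ stdSimplex ℝ Z)
    {g : (Fin (c + 1) → A) → Z → ℝ} (hg : piSum (fun _ => P) (fun v => ∑ z, Q v z * g v z) = 0)
    {i k : Fin N} (h : (i : ℕ) + c < k ∨ (k : ℕ) + c < i) :
    piSum (fun _ : Fin (N + c) => P) (fun x => piSum (fun i : Fin N => Q (window x i))
      (fun z => g (window x i) (z i) * g (window x k) (z k))) = 0 := by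
  have hik : i ≠ k := by rintro rfl; omega
  have h1 : ∀ x : Fin (N + c) → A, piSum (fun i : Fin N => Q (window x i))
      (fun z => g (window x i) (z i) * g (window x k) (z k)) =
      (∑ z, Q (window x i) z * g (window x i) z) *
        ∑ z, Q (window x k) z * g (window x k) z := by
    intro x
    refine (piSum_pair (fun i => (hQ _).2) hik
      (fun a b => g (window x i) a * g (window x k) b)).trans ?_
    rw [Finset.sum_mul_sum]
    refine Finset.sum_congr rfl fun a _ => ?_
    rw [Finset.mul_sum]
    exact Finset.sum_congr rfl fun b _ => by ring
  simp only [h1]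
  rcases h with h | h
  · rw [piSum_window_mul_window hP h (fun v => ∑ z, Q v z * g v z)
      (fun v => ∑ z, Q v z * g v z), hg, zero_mul]
  · simp only [mul_comm (∑ z, Q (window _ i) z * g (window _ i) z)]
    rw [piSum_window_mul_window hP h (fun v => ∑ z, Q v z * g v z)
      (fun v => ∑ z, Q v z * g v z), hg, zero_mul]

/-- Each window overlaps at most `2 * c + 1` windows, itself included; all other covariances vanish,
so the variance is linear in `N`. -/
lemma window_variance {P : A → ℝ} (hP : P ∈ stdSimplex ℝ A)
    {Q : (Fin (c + 1) → A) → Z → ℝ} (hQ : ∀ v, Q v ∈ stdSimplex ℝ Z)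
    {g : (Fin (c + 1) → A) → Z → ℝ} (hg : piSum (fun _ => P) (fun v => ∑ z, Q v z * g v z) = 0)
    {B : ℝ} (hB : ∀ v z, |g v z| ≤ B) :
    piSum (fun _ : Fin (N + c) => P) (fun x => piSum (fun i : Fin N => Q (window x i))
      (fun z => (∑ i, g (window x i) (z i)) ^ 2)) ≤ N * ((2 * c + 1) * B ^ 2) := by
  simp only [sq (∑ i, g _ _), Finset.sum_mul_sum, piSum_sum]
  have hrow : ∀ i : Fin N, ∑ k : Fin N, piSum (fun _ : Fin (N + c) => P)
      (fun x => piSum (fun i : Fin N => Q (window x i))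
        (fun z => g (window x i) (z i) * g (window x k) (z k))) ≤ (2 * c + 1) * B ^ 2 := by
    intro i
    have hterm : ∀ k : Fin N, piSum (fun _ : Fin (N + c) => P)
        (fun x => piSum (fun i : Fin N => Q (window x i))
          (fun z => g (window x i) (z i) * g (window x k) (z k))) ≤
        if ¬ ((i : ℕ) + c < k ∨ (k : ℕ) + c < i) then B ^ 2 else 0 := by
      intro k
      split_ifs with h
      · exact (window_covariance hP hQ hg h).le
      · refine piSum_le (fun _ => hP) fun x => piSum_le (fun i => hQ _) fun z => ?_
        refine (le_abs_self _).trans ?_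
        rw [abs_mul, sq]
        exact mul_le_mul (hB _ _) (hB _ _) (abs_nonneg _) ((abs_nonneg _).trans (hB (window x i) (z i)))
    refine (Finset.sum_le_sum fun k _ => hterm k).trans ?_
    rw [← Finset.sum_filter, Finset.sum_const, nsmul_eq_mul]
    exact mul_le_mul_of_nonneg_right (card_close_le i c) (sq_nonneg B)
  refine (Finset.sum_le_sum fun i _ => hrow i).trans_eq ?_
  simp

/-- Weak law of large numbers for functions of the windows of an i.i.d. sequence and of outputs of
a memoryless channel driven by the windows. -/
lemma window_weak_law {P : A → ℝ} (hP : P ∈ stdSimplex ℝ A)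
    {Q : (Fin (c + 1) → A) → Z → ℝ} (hQ : ∀ v, Q v ∈ stdSimplex ℝ Z)
    (f : (Fin (c + 1) → A) → Z → ℝ) :
    ∃ C : ℝ, 0 ≤ C ∧ ∀ (N : ℕ) (δ r : ℝ), 0 < N → 0 < δ →
      r ≤ piSum (fun _ => P) (fun v => ∑ z, Q v z * f v z) →
      piSum (fun _ : Fin (N + c) => P) (fun x => piSum (fun i : Fin N => Q (window x i))
        (fun z => ind (∑ i, f (window x i) (z i) < N * (r - δ)))) ≤ C / (N * δ ^ 2) := by
  set μ := piSum (fun _ => P) (fun v => ∑ z, Q v z * f v z) with hμ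
  obtain ⟨B, hB⟩ : ∃ B : ℝ, ∀ v z, |f v z - μ| ≤ B := by
    refine ⟨∑ p : (Fin (c + 1) → A) × Z, |f p.1 p.2 - μ|, fun v z => ?_⟩
    exact Finset.single_le_sum (f := fun p : (Fin (c + 1) → A) × Z => |f p.1 p.2 - μ|)
      (fun _ _ => abs_nonneg _) (Finset.mem_univ (v, z))
  have hg : piSum (fun _ => P) (fun v => ∑ z, Q v z * (f v z - μ)) = 0 := by
    have h1 : ∀ v, ∑ z, Q v z * (f v z - μ) = ∑ z, Q v z * f v z + (-μ) := by
      intro v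
      simp only [mul_sub, Finset.sum_sub_distrib, ← Finset.sum_mul, (hQ v).2]
      ring
    simp only [h1, piSum_add]
    rw [piSum_const (fun _ => hP.2), ← hμ]
    ring
  refine ⟨(2 * c + 1) * B ^ 2, by positivity, fun N δ r hN hδ hr => ?_⟩
  have hN' : (0 : ℝ) < N := by exact_mod_cast hN
  have hvar := window_variance (N := N) hP hQ hg hB
  -- Chebyshev's inequality, pointwise: since `r ≤ μ`, the event forces a deviation of at least `N *
  -- δ` from the mean.
  have hpt : ∀ (x : Fin (N + c) → A) (z : Fin N → Z),
      ind (∑ i, f (window x i) (z i) < N * (r - δ)) ≤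
        (∑ i, (f (window x i) (z i) - μ)) ^ 2 * ((N * δ) ^ 2)⁻¹ := by
    intro x z
    by_cases h : ∑ i, f (window x i) (z i) < N * (r - δ)
    · rw [ind_of_true h, ← div_eq_mul_inv, one_le_div (by positivity)]
      have h2 : ∑ i, (f (window x i) (z i) - μ) ≤ -(N * δ) := by
        rw [Finset.sum_sub_distrib, Finset.sum_const, Finset.card_univ, Fintype.card_fin,
          nsmul_eq_mul]
        nlinarith [mul_le_mul_of_nonneg_left hr hN'.le]
      have h3 : 0 < N * δ := by positivity
      nlinarith
    · rw [ind_of_false h]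
      positivity
  have hmulc : ∀ (x : Fin (N + c) → A), piSum (fun i : Fin N => Q (window x i))
      (fun z => (∑ i, (f (window x i) (z i) - μ)) ^ 2 * ((N * δ) ^ 2)⁻¹) =
      piSum (fun i : Fin N => Q (window x i))
        (fun z => (∑ i, (f (window x i) (z i) - μ)) ^ 2) * ((N * δ) ^ 2)⁻¹ := by
    intro x
    simp only [piSum, Finset.sum_mul, mul_assoc]
  have hmul : piSum (fun _ : Fin (N + c) => P) (fun x => piSum (fun i : Fin N => Q (window x i))
        (fun z => (∑ i, (f (window x i) (z i) - μ)) ^ 2) * ((N * δ) ^ 2)⁻¹) =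
      piSum (fun _ : Fin (N + c) => P) (fun x => piSum (fun i : Fin N => Q (window x i))
        (fun z => (∑ i, (f (window x i) (z i) - μ)) ^ 2)) * ((N * δ) ^ 2)⁻¹ := by
    simp only [piSum, Finset.sum_mul, mul_assoc]
  calc _ ≤ piSum (fun _ : Fin (N + c) => P) (fun x => piSum (fun i : Fin N => Q (window x i))
        (fun z => (∑ i, (f (window x i) (z i) - μ)) ^ 2 * ((N * δ) ^ 2)⁻¹)) :=
        piSum_mono (fun _ => hP.1) fun x => piSum_mono (fun i => (hQ _).1) fun z => hpt x z
    _ ≤ N * ((2 * c + 1) * B ^ 2) * ((N * δ) ^ 2)⁻¹ := by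
        simp only [hmulc]
        rw [hmul]
        exact mul_le_mul_of_nonneg_right hvar (by positivity)
    _ = (2 * c + 1) * B ^ 2 / (N * δ ^ 2) := by
        field_simp

end Window

/-! ### Single-letter likelihood ratios -/

/-- The likelihood ratio has mean at most 1 when the input is independent of the output: the terms
are `P(a|b)`. Equality can fail because division by zero gives zero. -/
lemma sum_mul_div_marginals_le {α β : Type*} [Fintype α] [Fintype β] {p : α → β → ℝ}
    (hp : ∀ a b, 0 ≤ p a b) (b : β) :
    ∑ a, (∑ b', p a b') * (p a b / ((∑ b', p a b') * ∑ a', p a' b)) ≤ 1 := by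
  calc _ ≤ ∑ a, p a b / ∑ a', p a' b := by
        refine Finset.sum_le_sum fun a _ => ?_
        have h0 : 0 ≤ ∑ a', p a' b := Finset.sum_nonneg fun a' _ => hp a' b
        by_cases h : ∑ b', p a b' = 0
        · rw [h, zero_mul]
          exact div_nonneg (hp a b) h0
        · rw [← mul_div_assoc, mul_div_mul_left _ _ h]
    _ ≤ 1 := by
        rw [← Finset.sum_div]
        exact div_self_le_one _

section Densities

variable {X₁ X₂ Y : Type*} [Fintype X₁] [Fintype X₂] [Fintype Y] {dmin dmax : ℕ}
  {W : X₁ → X₂ → Y → ℝ} {P : X₁ → ℝ} {K : (Fin (dmin + dmax + 1) → X₁) → X₂ → ℝ}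

lemma sum_jointPMF_mul (W : X₁ → X₂ → Y → ℝ) (P : X₁ → ℝ)
    (K : (Fin (dmin + dmax + 1) → X₁) → X₂ → ℝ) (d : Delay dmin dmax)
    (v : Fin (dmin + dmax + 1) → X₁) (b : X₂) (y : Y) (g : X₁ → ℝ) :
    ∑ a, jointPMF W P K d a v b y * g a =
      (∏ j, P (v j)) * (K v b * W (v d.slot) b y * g (v d.slot)) := by
  rw [Finset.sum_eq_single (v d.slot)]
  · simp [jointPMF, mul_assoc]
  · intro a _ ha
    simp [jointPMF, ha]
  · intro h
    exact absurd (Finset.mem_univ _) h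

lemma sum_jointPMF (W : X₁ → X₂ → Y → ℝ) (P : X₁ → ℝ)
    (K : (Fin (dmin + dmax + 1) → X₁) → X₂ → ℝ) (d : Delay dmin dmax)
    (v : Fin (dmin + dmax + 1) → X₁) (b : X₂) (y : Y) :
    ∑ a, jointPMF W P K d a v b y = (∏ j, P (v j)) * (K v b * W (v d.slot) b y) := by
  simpa using sum_jointPMF_mul W P K d v b y fun _ => 1

lemma jointPMF_nonneg (hW : ∀ x₁ x₂, W x₁ x₂ ∈ stdSimplex ℝ Y) (hP : P ∈ stdSimplex ℝ X₁)
    (hK : ∀ v, K v ∈ stdSimplex ℝ X₂) (d : Delay dmin dmax) (a : X₁)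
    (v : Fin (dmin + dmax + 1) → X₁) (b : X₂) (y : Y) : 0 ≤ jointPMF W P K d a v b y := by
  unfold jointPMF
  refine mul_nonneg (mul_nonneg (mul_nonneg (Finset.prod_nonneg fun j _ => hP.1 _) ?_)
    ((hK v).1 b)) ((hW _ _).1 y)
  split_ifs <;> norm_num

/-- The joint law of the symbol of user 1 that enters the channel and of the output. -/
noncomputable def pmfX₁Y (W : X₁ → X₂ → Y → ℝ) (P : X₁ → ℝ)
    (K : (Fin (dmin + dmax + 1) → X₁) → X₂ → ℝ) (d : Delay dmin dmax) (a : X₁) (y : Y) : ℝ :=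
  ∑ v, ∑ b, jointPMF W P K d a v b y

/-- The likelihood ratio whose logarithm has mean `I_d(X₁;Y)`. -/
noncomputable def ratioX₁Y (W : X₁ → X₂ → Y → ℝ) (P : X₁ → ℝ)
    (K : (Fin (dmin + dmax + 1) → X₁) → X₂ → ℝ) (d : Delay dmin dmax) (a : X₁) (y : Y) : ℝ :=
  pmfX₁Y W P K d a y / ((∑ y', pmfX₁Y W P K d a y') * ∑ a', pmfX₁Y W P K d a' y)

/-- The joint law of the symbol of user 2, of the output and of the window. -/
noncomputable def pmfX₂YV (W : X₁ → X₂ → Y → ℝ) (P : X₁ → ℝ)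
    (K : (Fin (dmin + dmax + 1) → X₁) → X₂ → ℝ) (d : Delay dmin dmax) (b : X₂) (y : Y)
    (v : Fin (dmin + dmax + 1) → X₁) : ℝ :=
  ∑ a, jointPMF W P K d a v b y

/-- The likelihood ratio whose logarithm has mean `I_d(X₂;Y|V)`. -/
noncomputable def ratioX₂Y (W : X₁ → X₂ → Y → ℝ) (P : X₁ → ℝ)
    (K : (Fin (dmin + dmax + 1) → X₁) → X₂ → ℝ) (d : Delay dmin dmax)
    (v : Fin (dmin + dmax + 1) → X₁) (b : X₂) (y : Y) : ℝ :=
  (pmfX₂YV W P K d b y v * ∑ b', ∑ y', pmfX₂YV W P K d b' y' v) /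
    ((∑ y', pmfX₂YV W P K d b y' v) * ∑ b', pmfX₂YV W P K d b' y v)

/-- The law of the symbol of user 2 and of the output given the window. -/
def windowChannel (W : X₁ → X₂ → Y → ℝ) (K : (Fin (dmin + dmax + 1) → X₁) → X₂ → ℝ)
    (d : Delay dmin dmax) (v : Fin (dmin + dmax + 1) → X₁) (z : X₂ × Y) : ℝ :=
  K v z.1 * W (v d.slot) z.1 z.2

lemma windowChannel_mem (hW : ∀ x₁ x₂, W x₁ x₂ ∈ stdSimplex ℝ Y)
    (hK : ∀ v, K v ∈ stdSimplex ℝ X₂) (d : Delay dmin dmax)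
    (v : Fin (dmin + dmax + 1) → X₁) : windowChannel W K d v ∈ stdSimplex ℝ (X₂ × Y) := by
  refine ⟨fun z => mul_nonneg ((hK v).1 _) ((hW _ _).1 _), ?_⟩
  simp only [windowChannel, Fintype.sum_prod_type, ← Finset.mul_sum, (hW _ _).2, mul_one]
  exact (hK v).2

lemma pmfX₂YV_eq (d : Delay dmin dmax) (b : X₂) (y : Y) (v : Fin (dmin + dmax + 1) → X₁) :
    pmfX₂YV W P K d b y v = (∏ j, P (v j)) * windowChannel W K d v (b, y) :=
  sum_jointPMF W P K d v b y

lemma sum_pmfX₁Y_mul (d : Delay dmin dmax) (g : X₁ → Y → ℝ) :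
    ∑ a, ∑ y, pmfX₁Y W P K d a y * g a y =
      piSum (fun _ => P) (fun v => ∑ z, windowChannel W K d v z * g (v d.slot) z.2) := by
  have h : ∀ v : Fin (dmin + dmax + 1) → X₁,
      (∏ j, P (v j)) * ∑ z, windowChannel W K d v z * g (v d.slot) z.2 =
      ∑ b, ∑ y, ∑ a, jointPMF W P K d a v b y * g a y := by
    intro v
    rw [Fintype.sum_prod_type]
    simp only [Finset.mul_sum]
    refine Finset.sum_congr rfl fun b _ => Finset.sum_congr rfl fun y _ => ?_
    exact (sum_jointPMF_mul W P K d v b y fun a => g a y).symm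
  simp only [piSum, h, pmfX₁Y, Finset.sum_mul]
  calc _ = ∑ y, ∑ a, ∑ v, ∑ b, jointPMF W P K d a v b y * g a y := Finset.sum_comm
    _ = ∑ y, ∑ v, ∑ b, ∑ a, jointPMF W P K d a v b y * g a y := by
        refine Finset.sum_congr rfl fun y _ => ?_
        rw [Finset.sum_comm]
        exact Finset.sum_congr rfl fun v _ => Finset.sum_comm
    _ = ∑ v, ∑ y, ∑ b, ∑ a, jointPMF W P K d a v b y * g a y := Finset.sum_comm
    _ = _ := Finset.sum_congr rfl fun v _ => Finset.sum_comm

lemma piSum_windowChannel_fst (hW : ∀ x₁ x₂, W x₁ x₂ ∈ stdSimplex ℝ Y)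
    (hP : P ∈ stdSimplex ℝ X₁) (hK : ∀ v, K v ∈ stdSimplex ℝ X₂) (d : Delay dmin dmax)
    (φ : X₁ → ℝ) :
    piSum (fun _ => P) (fun v => ∑ z, windowChannel W K d v z * φ (v d.slot)) =
      ∑ a, P a * φ a := by
  simp only [← Finset.sum_mul, (windowChannel_mem hW hK d _).2, one_mul]
  exact piSum_single (fun _ => hP.2) d.slot φ

lemma sum_pmfX₁Y (hW : ∀ x₁ x₂, W x₁ x₂ ∈ stdSimplex ℝ Y)
    (hP : P ∈ stdSimplex ℝ X₁) (hK : ∀ v, K v ∈ stdSimplex ℝ X₂) (d : Delay dmin dmax)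
    (a : X₁) : ∑ y, pmfX₁Y W P K d a y = P a := by
  classical
  have h := sum_pmfX₁Y_mul (W := W) (P := P) (K := K) d fun a' _ => if a' = a then 1 else 0
  rw [piSum_windowChannel_fst hW hP hK d fun a' => if a' = a then 1 else 0] at h
  simpa using h

lemma pmfX₁Y_nonneg (hW : ∀ x₁ x₂, W x₁ x₂ ∈ stdSimplex ℝ Y)
    (hP : P ∈ stdSimplex ℝ X₁) (hK : ∀ v, K v ∈ stdSimplex ℝ X₂) (d : Delay dmin dmax)
    (a : X₁) (y : Y) : 0 ≤ pmfX₁Y W P K d a y :=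
  Finset.sum_nonneg fun v _ => Finset.sum_nonneg fun b _ => jointPMF_nonneg hW hP hK d a v b y

lemma pmfX₂YV_nonneg (hW : ∀ x₁ x₂, W x₁ x₂ ∈ stdSimplex ℝ Y)
    (hP : P ∈ stdSimplex ℝ X₁) (hK : ∀ v, K v ∈ stdSimplex ℝ X₂) (d : Delay dmin dmax)
    (b : X₂) (y : Y) (v : Fin (dmin + dmax + 1) → X₁) : 0 ≤ pmfX₂YV W P K d b y v :=
  Finset.sum_nonneg fun a _ => jointPMF_nonneg hW hP hK d a v b y

lemma ratioX₁Y_nonneg (hW : ∀ x₁ x₂, W x₁ x₂ ∈ stdSimplex ℝ Y)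
    (hP : P ∈ stdSimplex ℝ X₁) (hK : ∀ v, K v ∈ stdSimplex ℝ X₂) (d : Delay dmin dmax)
    (a : X₁) (y : Y) : 0 ≤ ratioX₁Y W P K d a y :=
  div_nonneg (pmfX₁Y_nonneg hW hP hK d a y) <| mul_nonneg
    (Finset.sum_nonneg fun _ _ => pmfX₁Y_nonneg hW hP hK d _ _)
    (Finset.sum_nonneg fun _ _ => pmfX₁Y_nonneg hW hP hK d _ _)

lemma ratioX₂Y_nonneg (hW : ∀ x₁ x₂, W x₁ x₂ ∈ stdSimplex ℝ Y)
    (hP : P ∈ stdSimplex ℝ X₁) (hK : ∀ v, K v ∈ stdSimplex ℝ X₂) (d : Delay dmin dmax)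
    (v : Fin (dmin + dmax + 1) → X₁) (b : X₂) (y : Y) : 0 ≤ ratioX₂Y W P K d v b y :=
  div_nonneg (mul_nonneg (pmfX₂YV_nonneg hW hP hK d b y v)
    (Finset.sum_nonneg fun _ _ => Finset.sum_nonneg fun _ _ => pmfX₂YV_nonneg hW hP hK d _ _ _))
    <| mul_nonneg (Finset.sum_nonneg fun _ _ => pmfX₂YV_nonneg hW hP hK d _ _ _)
    (Finset.sum_nonneg fun _ _ => pmfX₂YV_nonneg hW hP hK d _ _ _)

lemma sum_mul_ratioX₁Y_le (hW : ∀ x₁ x₂, W x₁ x₂ ∈ stdSimplex ℝ Y)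
    (hP : P ∈ stdSimplex ℝ X₁) (hK : ∀ v, K v ∈ stdSimplex ℝ X₂) (d : Delay dmin dmax) (y : Y) :
    ∑ a, P a * ratioX₁Y W P K d a y ≤ 1 := by
  have h := sum_mul_div_marginals_le (pmfX₁Y_nonneg hW hP hK d) y
  refine le_of_eq_of_le (Finset.sum_congr rfl fun a _ => ?_) h
  unfold ratioX₁Y
  rw [sum_pmfX₁Y hW hP hK]

lemma sum_pmfX₂YV_output (hW : ∀ x₁ x₂, W x₁ x₂ ∈ stdSimplex ℝ Y) (d : Delay dmin dmax)
    (b : X₂) (v : Fin (dmin + dmax + 1) → X₁) :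
    ∑ y, pmfX₂YV W P K d b y v = (∏ j, P (v j)) * K v b := by
  simp only [pmfX₂YV_eq, windowChannel, ← Finset.mul_sum, (hW _ _).2, mul_one]

lemma sum_mul_ratioX₂Y_le (hW : ∀ x₁ x₂, W x₁ x₂ ∈ stdSimplex ℝ Y)
    (hP : P ∈ stdSimplex ℝ X₁) (hK : ∀ v, K v ∈ stdSimplex ℝ X₂) (d : Delay dmin dmax)
    (v : Fin (dmin + dmax + 1) → X₁) (y : Y) :
    ∑ b, K v b * ratioX₂Y W P K d v b y ≤ 1 := by
  have h := sum_mul_div_marginals_le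
    (p := fun b y => pmfX₂YV W P K d b y v) (fun b y => pmfX₂YV_nonneg hW hP hK d b y v) y
  refine le_of_eq_of_le (Finset.sum_congr rfl fun b _ => ?_) h
  have hR : ∑ b, ∑ y, pmfX₂YV W P K d b y v = ∏ j, P (v j) := by
    simp only [sum_pmfX₂YV_output hW, ← Finset.mul_sum, (hK v).2, mul_one]
  unfold ratioX₂Y
  rw [hR, sum_pmfX₂YV_output hW]
  ring

/-- Positivity on the support is what allows passing between products of ratios and sums of their
logarithms. -/
lemma ratioX₁Y_pos (hW : ∀ x₁ x₂, W x₁ x₂ ∈ stdSimplex ℝ Y)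
    (hP : P ∈ stdSimplex ℝ X₁) (hK : ∀ v, K v ∈ stdSimplex ℝ X₂) (d : Delay dmin dmax)
    {v : Fin (dmin + dmax + 1) → X₁} (hv : ∀ j, P (v j) ≠ 0) {z : X₂ × Y}
    (hz : windowChannel W K d v z ≠ 0) : 0 < ratioX₁Y W P K d (v d.slot) z.2 := by
  have h1 : 0 < ∑ a, jointPMF W P K d a v z.1 z.2 := by
    have : ∑ a, jointPMF W P K d a v z.1 z.2 = (∏ j, P (v j)) * windowChannel W K d v z :=
      sum_jointPMF W P K d v z.1 z.2
    rw [this]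
    exact mul_pos (Finset.prod_pos fun j _ => (hP.1 _).lt_of_ne' (hv j))
      (((windowChannel_mem hW hK d v).1 z).lt_of_ne' hz)
  have h2 : 0 < jointPMF W P K d (v d.slot) v z.1 z.2 := by
    rw [Finset.sum_eq_single (v d.slot)] at h1
    · exact h1
    · intro a _ ha
      simp [jointPMF, ha]
    · intro h
      exact absurd (Finset.mem_univ _) h
  have h3 : 0 < pmfX₁Y W P K d (v d.slot) z.2 :=
    Finset.sum_pos' (fun v' _ => Finset.sum_nonneg fun b _ => jointPMF_nonneg hW hP hK d _ _ _ _)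
      ⟨v, Finset.mem_univ _, Finset.sum_pos' (fun b _ => jointPMF_nonneg hW hP hK d _ _ _ _)
        ⟨z.1, Finset.mem_univ _, h2⟩⟩
  refine div_pos h3 (mul_pos ?_ ?_)
  · exact Finset.sum_pos' (fun _ _ => pmfX₁Y_nonneg hW hP hK d _ _) ⟨_, Finset.mem_univ _, h3⟩
  · exact Finset.sum_pos' (fun _ _ => pmfX₁Y_nonneg hW hP hK d _ _) ⟨_, Finset.mem_univ _, h3⟩

lemma ratioX₂Y_pos (hW : ∀ x₁ x₂, W x₁ x₂ ∈ stdSimplex ℝ Y)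
    (hP : P ∈ stdSimplex ℝ X₁) (hK : ∀ v, K v ∈ stdSimplex ℝ X₂) (d : Delay dmin dmax)
    {v : Fin (dmin + dmax + 1) → X₁} (hv : ∀ j, P (v j) ≠ 0) {z : X₂ × Y}
    (hz : windowChannel W K d v z ≠ 0) : 0 < ratioX₂Y W P K d v z.1 z.2 := by
  have h3 : 0 < pmfX₂YV W P K d z.1 z.2 v := by
    rw [pmfX₂YV_eq]
    exact mul_pos (Finset.prod_pos fun j _ => (hP.1 _).lt_of_ne' (hv j))
      (((windowChannel_mem hW hK d v).1 z).lt_of_ne' hz)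
  have h4 : 0 < ∑ y, pmfX₂YV W P K d z.1 y v :=
    Finset.sum_pos' (fun _ _ => pmfX₂YV_nonneg hW hP hK d _ _ _) ⟨_, Finset.mem_univ _, h3⟩
  refine div_pos (mul_pos h3 ?_) (mul_pos h4 ?_)
  · exact Finset.sum_pos' (fun _ _ => Finset.sum_nonneg fun _ _ =>
      pmfX₂YV_nonneg hW hP hK d _ _ _) ⟨_, Finset.mem_univ _, h4⟩
  · exact Finset.sum_pos' (fun _ _ => pmfX₂YV_nonneg hW hP hK d _ _ _) ⟨_, Finset.mem_univ _, h3⟩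

lemma infoX₁Y_eq (d : Delay dmin dmax) :
    infoX₁Y W P K d = piSum (fun _ => P) (fun v => ∑ z, windowChannel W K d v z *
      Real.logb 2 (ratioX₁Y W P K d (v d.slot) z.2)) :=
  sum_pmfX₁Y_mul d fun a y => Real.logb 2 (ratioX₁Y W P K d a y)

lemma infoX₂YGivenV_eq (d : Delay dmin dmax) :
    infoX₂YGivenV W P K d = piSum (fun _ => P) (fun v => ∑ z, windowChannel W K d v z *
      Real.logb 2 (ratioX₂Y W P K d v z.1 z.2)) := by
  have h : infoX₂YGivenV W P K d = ∑ b, ∑ y, ∑ v, pmfX₂YV W P K d b y v *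
      Real.logb 2 (ratioX₂Y W P K d v b y) := rfl
  have h2 : ∀ b : X₂, ∑ y, ∑ v, pmfX₂YV W P K d b y v * Real.logb 2 (ratioX₂Y W P K d v b y) =
      ∑ v, ∑ y, pmfX₂YV W P K d b y v * Real.logb 2 (ratioX₂Y W P K d v b y) :=
    fun b => Finset.sum_comm
  rw [h]
  simp only [h2]
  rw [Finset.sum_comm]
  refine Finset.sum_congr rfl fun v _ => ?_
  simp only [Fintype.sum_prod_type, Finset.mul_sum, pmfX₂YV_eq, mul_assoc]

/-- Puts the entropy in the form of a window mean, so that `window_weak_law` covers it too. -/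
lemma entropy_eq (hW : ∀ x₁ x₂, W x₁ x₂ ∈ stdSimplex ℝ Y) (hP : P ∈ stdSimplex ℝ X₁)
    (hK : ∀ v, K v ∈ stdSimplex ℝ X₂) (d : Delay dmin dmax) :
    entropy P = piSum (fun _ => P) (fun v => ∑ z, windowChannel W K d v z *
      -Real.logb 2 (P (v d.slot))) := by
  rw [piSum_windowChannel_fst hW hP hK d fun a => -Real.logb 2 (P a)]
  simp [entropy]

end Densities

/-! ### The random block code and its error exponents -/

section Block

variable {X₁ X₂ Y : Type*} [Fintype X₁] [Fintype X₂] [Fintype Y] {dmin dmax : ℕ}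
  {W : X₁ → X₂ → Y → ℝ} {P : X₁ → ℝ} {K : (Fin (dmin + dmax + 1) → X₁) → X₂ → ℝ}

noncomputable instance : Fintype (Delay dmin dmax) :=
  Fintype.subtype (Finset.Icc (-(dmin : ℤ)) dmax) fun _ => Finset.mem_Icc

lemma prod_mem_stdSimplex {ι α : Type*} [Fintype ι] [DecidableEq ι] [Fintype α] {p : ι → α → ℝ}
    (hp : ∀ i, p i ∈ stdSimplex ℝ α) : (fun x : ι → α => ∏ i, p i (x i)) ∈ stdSimplex ℝ (ι → α) :=
  ⟨fun x => Finset.prod_nonneg fun i _ => (hp i).1 _, by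
    simpa [piSum] using piSum_const (fun i => (hp i).2) 1⟩

lemma piSum_mono_of_ne_zero {ι α : Type*} [Fintype ι] [DecidableEq ι] [Fintype α]
    {p : ι → α → ℝ} (hp : ∀ i a, 0 ≤ p i a) {F G : (ι → α) → ℝ}
    (h : ∀ x : ι → α, (∀ i, p i (x i) ≠ 0) → F x ≤ G x) : piSum p F ≤ piSum p G := by
  refine Finset.sum_le_sum fun x _ => ?_
  by_cases hx : ∏ i, p i (x i) = 0
  · rw [hx, zero_mul, zero_mul]
  · exact mul_le_mul_of_nonneg_left (h x fun i => Finset.prod_ne_zero_iff.1 hx i (Finset.mem_univ _))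
      (Finset.prod_nonneg fun i _ => hp i _)

/-- The decoding test: under some delay the likelihood ratios of the pair of codewords, and of the
codeword of user 2 given that of user 1, exceed their thresholds. -/
def Pass (W : X₁ → X₂ → Y → ℝ) (P : X₁ → ℝ) (K : (Fin (dmin + dmax + 1) → X₁) → X₂ → ℝ) {N : ℕ}
    (θ₁₂ θ₂ : ℝ) (x : Fin (N + (dmin + dmax)) → X₁) (s : Fin N → X₂) (t : Fin N → Y) : Prop :=
  ∃ d : Delay dmin dmax,
    θ₁₂ ≤ ∏ i, ratioX₁Y W P K d (window x i d.slot) (t i) *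
      ratioX₂Y W P K d (window x i) (s i) (t i) ∧
    θ₂ ≤ ∏ i, ratioX₂Y W P K d (window x i) (s i) (t i)

/-- Markov's inequality and the union bound, before taking means. -/
lemma ind_exists_le {Δ : Type*} [Fintype Δ] {p : Δ → Prop} {θ : ℝ} (hθ : 0 < θ) {f : Δ → ℝ}
    (hf : ∀ d, 0 ≤ f d) (h : ∀ d, p d → θ ≤ f d) : ind (∃ d, p d) ≤ ∑ d, f d * θ⁻¹ := by
  have h0 : ∀ d ∈ Finset.univ, 0 ≤ f d * θ⁻¹ := fun d _ =>
    mul_nonneg (hf d) (inv_nonneg.2 hθ.le)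
  by_cases hp : ∃ d, p d
  · rw [ind_of_true hp]
    obtain ⟨d, hd⟩ := hp
    refine le_trans ?_ (Finset.single_le_sum h0 (Finset.mem_univ d))
    rw [← div_eq_mul_inv, one_le_div hθ]
    exact h d hd
  · rw [ind_of_false hp]
    exact Finset.sum_nonneg h0

variable {N : ℕ}

/-- With `x` and `t` fixed, the mean of the product of ratios factors over time, and each factor is
at most 1. -/
lemma sum_ind_Pass_second_le (hW : ∀ x₁ x₂, W x₁ x₂ ∈ stdSimplex ℝ Y)
    (hP : P ∈ stdSimplex ℝ X₁) (hK : ∀ v, K v ∈ stdSimplex ℝ X₂) (θ₁₂ : ℝ) {θ₂ : ℝ} (hθ : 0 < θ₂)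
    (x : Fin (N + (dmin + dmax)) → X₁) (t : Fin N → Y) :
    ∑ s : Fin N → X₂, (∏ i, K (window x i) (s i)) * ind (Pass W P K θ₁₂ θ₂ x s t) ≤
      Fintype.card (Delay dmin dmax) * θ₂⁻¹ := by
  have h1 : ∀ s : Fin N → X₂, ind (Pass W P K θ₁₂ θ₂ x s t) ≤
      ∑ d : Delay dmin dmax, (∏ i, ratioX₂Y W P K d (window x i) (s i) (t i)) * θ₂⁻¹ := fun s =>
    ind_exists_le hθ (fun d => Finset.prod_nonneg fun i _ => ratioX₂Y_nonneg hW hP hK d _ _ _)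
      fun d hd => hd.2
  have h2 : ∀ d : Delay dmin dmax, piSum (fun i => K (window x i))
      (fun s => (∏ i, ratioX₂Y W P K d (window x i) (s i) (t i)) * θ₂⁻¹) ≤ θ₂⁻¹ := by
    intro d
    have h3 := piSum_prod (fun i => K (window x i))
      (fun i b => ratioX₂Y W P K d (window x i) b (t i))
    have h4 : piSum (fun i => K (window x i))
        (fun s => (∏ i, ratioX₂Y W P K d (window x i) (s i) (t i)) * θ₂⁻¹) =
        piSum (fun i => K (window x i))
        (fun s => ∏ i, ratioX₂Y W P K d (window x i) (s i) (t i)) * θ₂⁻¹ := by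
      simp only [piSum, Finset.sum_mul, mul_assoc]
    rw [h4, h3]
    refine mul_le_of_le_one_left (inv_nonneg.2 hθ.le) (Finset.prod_le_one (fun i _ => ?_)
      fun i _ => sum_mul_ratioX₂Y_le hW hP hK d _ _)
    exact Finset.sum_nonneg fun b _ => mul_nonneg ((hK _).1 _) (ratioX₂Y_nonneg hW hP hK d _ _ _)
  refine (piSum_mono (fun i => (hK (window x i)).1) h1).trans ?_
  rw [piSum_sum]
  refine (Finset.sum_le_sum fun d _ => h2 d).trans_eq ?_
  simp

/-- Averaging over `s` first bounds the ratios of user 2 by 1. What is left depends on `x` only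
through one slot of each window. -/
lemma sum_ind_Pass_first_le (hW : ∀ x₁ x₂, W x₁ x₂ ∈ stdSimplex ℝ Y)
    (hP : P ∈ stdSimplex ℝ X₁) (hK : ∀ v, K v ∈ stdSimplex ℝ X₂) {θ₁₂ : ℝ} (θ₂ : ℝ) (hθ : 0 < θ₁₂)
    (t : Fin N → Y) :
    ∑ x : Fin (N + (dmin + dmax)) → X₁, (∏ k, P (x k)) *
      ∑ s : Fin N → X₂, (∏ i, K (window x i) (s i)) * ind (Pass W P K θ₁₂ θ₂ x s t) ≤
      Fintype.card (Delay dmin dmax) * θ₁₂⁻¹ := by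
  have h1 : ∀ (x : Fin (N + (dmin + dmax)) → X₁) (s : Fin N → X₂),
      ind (Pass W P K θ₁₂ θ₂ x s t) ≤
      ∑ d : Delay dmin dmax, (∏ i, ratioX₁Y W P K d (window x i d.slot) (t i) *
      ratioX₂Y W P K d (window x i) (s i) (t i)) * θ₁₂⁻¹ := fun x s =>
    ind_exists_le hθ (fun d => Finset.prod_nonneg fun i _ =>
      mul_nonneg (ratioX₁Y_nonneg hW hP hK d _ _) (ratioX₂Y_nonneg hW hP hK d _ _ _))
      fun d hd => hd.1
  have h2 : ∀ (d : Delay dmin dmax) (x : Fin (N + (dmin + dmax)) → X₁),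
      piSum (fun i => K (window x i)) (fun s => (∏ i, ratioX₁Y W P K d (window x i d.slot) (t i) *
      ratioX₂Y W P K d (window x i) (s i) (t i)) * θ₁₂⁻¹) ≤
      (∏ i, ratioX₁Y W P K d (window x i d.slot) (t i)) * θ₁₂⁻¹ := by
    intro d x
    have h3 := piSum_prod (fun i => K (window x i))
      (fun i b => ratioX₁Y W P K d (window x i d.slot) (t i) *
        ratioX₂Y W P K d (window x i) b (t i))
    have h4 : piSum (fun i => K (window x i))
        (fun s => (∏ i, ratioX₁Y W P K d (window x i d.slot) (t i) *
          ratioX₂Y W P K d (window x i) (s i) (t i)) * θ₁₂⁻¹) =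
        piSum (fun i => K (window x i))
        (fun s => ∏ i, ratioX₁Y W P K d (window x i d.slot) (t i) *
          ratioX₂Y W P K d (window x i) (s i) (t i)) * θ₁₂⁻¹ := by
      simp only [piSum, Finset.sum_mul, mul_assoc]
    rw [h4, h3]
    refine mul_le_mul_of_nonneg_right (Finset.prod_le_prod (fun i _ => ?_) fun i _ => ?_)
      (inv_nonneg.2 hθ.le)
    · exact Finset.sum_nonneg fun b _ => mul_nonneg ((hK _).1 _)
        (mul_nonneg (ratioX₁Y_nonneg hW hP hK d _ _) (ratioX₂Y_nonneg hW hP hK d _ _ _))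
    · simp only [mul_left_comm (K _ _), ← Finset.mul_sum]
      exact mul_le_of_le_one_right (ratioX₁Y_nonneg hW hP hK d _ _)
        (sum_mul_ratioX₂Y_le hW hP hK d _ _)
  have h5 : ∀ d : Delay dmin dmax, piSum (fun _ : Fin (N + (dmin + dmax)) => P)
      (fun x => (∏ i, ratioX₁Y W P K d (window x i d.slot) (t i)) * θ₁₂⁻¹) ≤ θ₁₂⁻¹ := by
    intro d
    -- The windows overlap, but their entries at a fixed slot are distinct coordinates of `x`, so
    -- the mean factors.
    have hσ : Function.Injective
        (fun i : Fin N => (⟨i + d.slot, by omega⟩ : Fin (N + (dmin + dmax)))) := by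
      intro a b h
      simp only [Fin.mk.injEq] at h
      exact Fin.ext (by omega)
    refine (piSum_comp_injective (fun _ => hP.2) hσ
      (fun w => (∏ i, ratioX₁Y W P K d (w i) (t i)) * θ₁₂⁻¹)).trans_le ?_
    have h3 := piSum_prod (fun _ : Fin N => P) (fun i a => ratioX₁Y W P K d a (t i))
    have h4 : piSum (fun _ : Fin N => P)
        (fun w => (∏ i, ratioX₁Y W P K d (w i) (t i)) * θ₁₂⁻¹) =
        piSum (fun _ : Fin N => P) (fun w => ∏ i, ratioX₁Y W P K d (w i) (t i)) * θ₁₂⁻¹ := by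
      simp only [piSum, Finset.sum_mul, mul_assoc]
    rw [h4, h3]
    refine mul_le_of_le_one_left (inv_nonneg.2 hθ.le) (Finset.prod_le_one (fun i _ => ?_)
      fun i _ => sum_mul_ratioX₁Y_le hW hP hK d _)
    exact Finset.sum_nonneg fun b _ => mul_nonneg (hP.1 _) (ratioX₁Y_nonneg hW hP hK d _ _)
  calc _ ≤ piSum (fun _ : Fin (N + (dmin + dmax)) => P) (fun x => ∑ d : Delay dmin dmax,
        (∏ i, ratioX₁Y W P K d (window x i d.slot) (t i)) * θ₁₂⁻¹) := by
        refine piSum_mono (fun _ => hP.1) fun x => ?_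
        refine (piSum_mono (fun i => (hK (window x i)).1) (h1 x)).trans ?_
        rw [piSum_sum]
        exact Finset.sum_le_sum fun d _ => h2 d x
    _ ≤ _ := by
        rw [piSum_sum]
        refine (Finset.sum_le_sum fun d _ => h5 d).trans_eq ?_
        simp

/-- Factors of the remaining coordinates are at most 1. This reduces the probability of a whole
codeword to a sum over windows. -/
lemma prod_le_prod_window (hP : P ∈ stdSimplex ℝ X₁) (x : Fin (N + (dmin + dmax)) → X₁)
    (j : Fin (dmin + dmax + 1)) : ∏ k, P (x k) ≤ ∏ i : Fin N, P (window x i j) := by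
  have hσ : Function.Injective
      (fun i : Fin N => (⟨i + j, by omega⟩ : Fin (N + (dmin + dmax)))) := by
    intro a b h
    simp only [Fin.mk.injEq] at h
    exact Fin.ext (by omega)
  have h1 : ∏ i : Fin N, P (window x i j) = ∏ k ∈ Finset.univ.map ⟨_, hσ⟩, P (x k) := by
    rw [Finset.prod_map]
    rfl
  have hle : ∀ a, P a ≤ 1 := fun a => by
    rw [← hP.2]
    exact Finset.single_le_sum (fun b _ => hP.1 b) (Finset.mem_univ a)
  rw [h1, ← Finset.prod_mul_prod_compl (Finset.univ.map ⟨_, hσ⟩)]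
  exact mul_le_of_le_one_right (Finset.prod_nonneg fun _ _ => hP.1 _)
    (Finset.prod_le_one (fun _ _ => hP.1 _) fun _ _ => hle _)

lemma rpow_le_prod_iff {f : Fin N → ℝ} (hf : ∀ i, 0 < f i) (r : ℝ) :
    (2 : ℝ) ^ r ≤ ∏ i, f i ↔ r ≤ ∑ i, Real.logb 2 (f i) := by
  rw [← Real.logb_prod _ _ (fun i _ => (hf i).ne'),
    Real.le_logb_iff_rpow_le (by norm_num) (Finset.prod_pos fun i _ => hf i)]

lemma ind_not_Pass_le (hW : ∀ x₁ x₂, W x₁ x₂ ∈ stdSimplex ℝ Y)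
    (hP : P ∈ stdSimplex ℝ X₁) (hK : ∀ v, K v ∈ stdSimplex ℝ X₂) (d : Delay dmin dmax)
    (r₁₂ r₂ r₁ : ℝ) {x : Fin (N + (dmin + dmax)) → X₁} (hx : ∀ k, P (x k) ≠ 0)
    {z : Fin N → X₂ × Y} (hz : ∀ i, windowChannel W K d (window x i) (z i) ≠ 0) :
    ind (¬ (Pass W P K (2 ^ r₁₂) (2 ^ r₂) x (fun i => (z i).1) (fun i => (z i).2) ∧
      ∏ k, P (x k) ≤ 2 ^ (-r₁))) ≤
    ind (∑ i, (Real.logb 2 (ratioX₁Y W P K d (window x i d.slot) (z i).2) +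
        Real.logb 2 (ratioX₂Y W P K d (window x i) (z i).1 (z i).2)) < r₁₂) +
      ind (∑ i, Real.logb 2 (ratioX₂Y W P K d (window x i) (z i).1 (z i).2) < r₂) +
      ind (∑ i, -Real.logb 2 (P (window x i d.slot)) < r₁) := by
  have hr1 : ∀ i, 0 < ratioX₁Y W P K d (window x i d.slot) (z i).2 := fun i =>
    ratioX₁Y_pos hW hP hK d (v := window x i) (fun j => hx _) (hz i)
  have hr2 : ∀ i, 0 < ratioX₂Y W P K d (window x i) (z i).1 (z i).2 := fun i =>
    ratioX₂Y_pos hW hP hK d (v := window x i) (fun j => hx _) (hz i)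
  set A := ∑ i, (Real.logb 2 (ratioX₁Y W P K d (window x i d.slot) (z i).2) +
        Real.logb 2 (ratioX₂Y W P K d (window x i) (z i).1 (z i).2)) < r₁₂ with hA
  set B := ∑ i, Real.logb 2 (ratioX₂Y W P K d (window x i) (z i).1 (z i).2) < r₂ with hB
  set C := ∑ i, -Real.logb 2 (P (window x i d.slot)) < r₁ with hC
  have nA := ind_nonneg A
  have nB := ind_nonneg B
  have nC := ind_nonneg C
  have l1 := ind_le_one (¬ (Pass W P K (2 ^ r₁₂) (2 ^ r₂) x (fun i => (z i).1)
    (fun i => (z i).2) ∧ ∏ k, P (x k) ≤ 2 ^ (-r₁)))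
  by_cases a : A
  · rw [ind_of_true a]; linarith
  by_cases b : B
  · rw [ind_of_true b]; linarith
  by_cases c : C
  · rw [ind_of_true c]; linarith
  rw [ind_of_false]
  · linarith
  rw [not_not]
  rw [hA, not_lt] at a
  rw [hB, not_lt] at b
  rw [hC, not_lt] at c
  refine ⟨⟨d, ?_, (rpow_le_prod_iff hr2 _).2 b⟩, ?_⟩
  · rw [rpow_le_prod_iff fun i => mul_pos (hr1 i) (hr2 i)]
    simpa only [Real.logb_mul (hr1 _).ne' (hr2 _).ne'] using a
  · refine (prod_le_prod_window hP x d.slot).trans ?_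
    have hpos : ∀ i : Fin N, 0 < P (window x i d.slot) := fun i => (hP.1 _).lt_of_ne' (hx _)
    rw [← Real.logb_le_iff_le_rpow (by norm_num) (Finset.prod_pos fun i _ => hpos i),
      Real.logb_prod _ _ (fun i _ => (hpos i).ne')]
    rw [Finset.sum_neg_distrib] at c
    linarith

lemma sum_input_output_eq (d : Delay dmin dmax) (x : Fin (N + (dmin + dmax)) → X₁)
    (F : (Fin N → X₂) → (Fin N → Y) → ℝ) :
    ∑ s : Fin N → X₂, (∏ i, K (window x i) (s i)) *
      ∑ t : Fin N → Y, (∏ i, W (window x i d.slot) (s i) (t i)) * F s t =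
    piSum (fun i : Fin N => windowChannel W K d (window x i))
      (fun z => F (fun i => (z i).1) (fun i => (z i).2)) := by
  simp only [Finset.mul_sum, piSum]
  rw [← Fintype.sum_prod_type']
  refine Fintype.sum_equiv (Equiv.arrowProdEquivProdArrow (Fin N) (fun _ => X₂) (fun _ => Y)).symm
    _ _ fun p => ?_
  simp only [windowChannel, Finset.prod_mul_distrib, mul_assoc]
  rfl

/-- Three uses of the weak law: for the two ratios jointly, for that of user 2, and for the entropy.
The constant depends neither on `N` nor on `δ`. -/
lemma exists_atypical_bound (hW : ∀ x₁ x₂, W x₁ x₂ ∈ stdSimplex ℝ Y)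
    (hP : P ∈ stdSimplex ℝ X₁) (hK : ∀ v, K v ∈ stdSimplex ℝ X₂) {R₁ R₂ : ℝ}
    (h₁ : R₁ ≤ entropy P) (d : Delay dmin dmax) (h₂ : R₂ ≤ infoX₂YGivenV W P K d)
    (h₁₂ : R₁ + R₂ ≤ infoX₁Y W P K d + infoX₂YGivenV W P K d) :
    ∃ C : ℝ, 0 ≤ C ∧ ∀ (N : ℕ) (δ : ℝ), 0 < N → 0 < δ →
      ∑ x : Fin (N + (dmin + dmax)) → X₁, (∏ k, P (x k)) *
        ∑ s : Fin N → X₂, (∏ i, K (window x i) (s i)) *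
        ∑ t : Fin N → Y, (∏ i, W (window x i d.slot) (s i) (t i)) *
          ind (¬ (Pass W P K (2 ^ (N * (R₁ + R₂ - δ))) (2 ^ (N * (R₂ - δ))) x s t ∧
            ∏ k, P (x k) ≤ 2 ^ (-(N * (R₁ - δ))))) ≤ C / (N * δ ^ 2) := by
  have hQ := windowChannel_mem hW hK d
  obtain ⟨A, hA0, hA⟩ := window_weak_law hP hQ fun v z =>
    Real.logb 2 (ratioX₁Y W P K d (v d.slot) z.2) + Real.logb 2 (ratioX₂Y W P K d v z.1 z.2)
  obtain ⟨B, hB0, hB⟩ := window_weak_law hP hQ fun v z =>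
    Real.logb 2 (ratioX₂Y W P K d v z.1 z.2)
  obtain ⟨C, hC0, hC⟩ := window_weak_law hP hQ fun v _ => -Real.logb 2 (P (v d.slot))
  refine ⟨A + B + C, by positivity, fun N δ hN hδ => ?_⟩
  have hA' := hA N δ (R₁ + R₂) hN hδ (by
    rw [infoX₁Y_eq, infoX₂YGivenV_eq, ← piSum_add] at h₁₂
    simpa only [mul_add, Finset.sum_add_distrib] using h₁₂)
  have hB' := hB N δ R₂ hN hδ (by rwa [← infoX₂YGivenV_eq])
  have hC' := hC N δ R₁ hN hδ (by rwa [← entropy_eq hW hP hK])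
  rw [add_div, add_div]
  refine le_trans ?_ (add_le_add (add_le_add hA' hB') hC')
  rw [← piSum_add, ← piSum_add]
  refine piSum_mono_of_ne_zero (fun _ => hP.1) fun x hx => ?_
  rw [sum_input_output_eq d x fun s t =>
    ind (¬ (Pass W P K (2 ^ (N * (R₁ + R₂ - δ))) (2 ^ (N * (R₂ - δ))) x s t ∧
            ∏ k, P (x k) ≤ 2 ^ (-(N * (R₁ - δ))))), ← piSum_add, ← piSum_add]
  exact piSum_mono_of_ne_zero (fun i => (hQ _).1) fun z hz =>
    ind_not_Pass_le hW hP hK d _ _ _ hx hz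

/-- There is a block code whose errors, summed over the delays, are small on average. -/
lemma exists_interior_code (hW : ∀ x₁ x₂, W x₁ x₂ ∈ stdSimplex ℝ Y)
    (hP : P ∈ stdSimplex ℝ X₁) (hK : ∀ v, K v ∈ stdSimplex ℝ X₂) {R₁ R₂ : ℝ}
    (h₁ : R₁ ≤ entropy P) (h₂ : ∀ d : Delay dmin dmax, R₂ ≤ infoX₂YGivenV W P K d)
    (h₁₂ : ∀ d : Delay dmin dmax, R₁ + R₂ ≤ infoX₁Y W P K d + infoX₂YGivenV W P K d) :
    ∃ C : ℝ, 0 ≤ C ∧ ∀ (N M₁ M₂ : ℕ) (δ : ℝ), 0 < N → 0 < M₁ → 0 < M₂ → 0 < δ →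
      ∃ (C₁ : Fin M₁ → Fin (N + (dmin + dmax)) → X₁)
        (C₂ : (Fin (N + (dmin + dmax)) → X₁) → Fin M₂ → Fin N → X₂)
        (dec : (Fin N → Y) → Fin M₁ × Fin M₂),
      ∑ m₁, ∑ m₂, ∑ d : Delay dmin dmax, ∑ t : Fin N → Y,
        (∏ i, W (window (C₁ m₁) i d.slot) (C₂ (C₁ m₁) m₂ i) (t i)) * ind (dec t ≠ (m₁, m₂)) ≤
      (M₁ : ℝ) * M₂ * (C * ((N * δ ^ 2)⁻¹ + ((M₂ : ℝ) - 1) * 2 ^ (-(N * (R₂ - δ))) +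
        ((M₁ : ℝ) - 1) * 2 ^ (-(N * (R₁ - δ))) +
        ((M₁ : ℝ) - 1) * M₂ * 2 ^ (-(N * (R₁ + R₂ - δ))))) := by
  choose A hA0 hA using fun d => exists_atypical_bound hW hP hK h₁ d (h₂ d) (h₁₂ d)
  set D : ℝ := ((Fintype.card (Delay dmin dmax) : ℕ) : ℝ) with hD
  have hD0 : 0 ≤ D := Nat.cast_nonneg _
  have hA1 : 0 ≤ ∑ d, A d := Finset.sum_nonneg fun d _ => hA0 d
  -- One factor `D` comes from summing the errors over delays, a second from the union over delays
  -- in the test; collisions only incur the first.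
  refine ⟨∑ d, A d + D * D + D, by positivity, fun N M₁ M₂ δ hN hM₁ hM₂ hδ => ?_⟩
  have p1 : (0 : ℝ) < 2 ^ (N * (R₁ + R₂ - δ)) := by positivity
  have p2 : (0 : ℝ) < 2 ^ (N * (R₂ - δ)) := by positivity
  have p3 : (0 : ℝ) ≤ 2 ^ (-(N * (R₁ - δ))) := by positivity
  obtain ⟨C₁, C₂, dec, h⟩ := exists_oneShot_code (M₁ := M₁) (M₂ := M₂)
    (π := fun x : Fin (N + (dmin + dmax)) → X₁ => ∏ k, P (x k))
    (κ := fun x (s : Fin N → X₂) => ∏ i, K (window x i) (s i))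
    (ω := fun (d : Delay dmin dmax) x s (t : Fin N → Y) =>
      ∏ i, W (window x i d.slot) (s i) (t i))
    (prod_mem_stdSimplex fun _ => hP) (fun x => prod_mem_stdSimplex fun i => hK _)
    (fun d x s => prod_mem_stdSimplex fun i => hW _ _) p3
    (sum_ind_Pass_second_le hW hP hK (2 ^ (N * (R₁ + R₂ - δ))) p2)
    (sum_ind_Pass_first_le hW hP hK (2 ^ (N * (R₂ - δ))) p1) hM₁ hM₂
  refine ⟨C₁, C₂, dec, h.trans (mul_le_mul_of_nonneg_left ?_ (by positivity))⟩
  have hS := Finset.sum_le_sum fun d (_ : d ∈ Finset.univ) => hA d N δ hN hδ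
  rw [← Finset.sum_div, div_eq_mul_inv] at hS
  refine (add_le_add_left hS _).trans ?_
  rw [← hD, ← Real.rpow_neg (by norm_num), ← Real.rpow_neg (by norm_num)]
  have m1 : (0 : ℝ) ≤ (M₁ : ℝ) - 1 := by
    rw [sub_nonneg]; exact_mod_cast hM₁
  have m2 : (0 : ℝ) ≤ (M₂ : ℝ) - 1 := by
    rw [sub_nonneg]; exact_mod_cast hM₂
  have q0 : 0 ≤ ((N : ℝ) * δ ^ 2)⁻¹ := by positivity
  have q2 : 0 ≤ ((M₂ : ℝ) - 1) * 2 ^ (-(N * (R₂ - δ))) := by positivity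
  have q1 : 0 ≤ ((M₁ : ℝ) - 1) * 2 ^ (-(N * (R₁ - δ))) := by positivity
  have q3 : 0 ≤ ((M₁ : ℝ) - 1) * M₂ * 2 ^ (-(N * (R₁ + R₂ - δ))) := by positivity
  have hDD : 0 ≤ D * D := by positivity
  nlinarith [mul_nonneg hA1 q1, mul_nonneg hA1 q2, mul_nonneg hA1 q3, mul_nonneg hDD q0,
    mul_nonneg hD0 q0, mul_nonneg hDD q1, mul_nonneg hD0 q2, mul_nonneg hD0 q3]

end Block

/-! ### Robust codes: boundary symbols, trimming, concatenation -/

section HasCode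

variable {X₁ X₂ Y : Type*} [Fintype X₁] [Fintype X₂] [Fintype Y] {dmin dmax : ℕ}
  {W : X₁ → X₂ → Y → ℝ}

/-- There is a code whose error probability, maximized for each message pair over the delays and
over the symbols outside the block, is at most `ε` on average over the message pairs. -/
def HasCode (dmin dmax : ℕ) (W : X₁ → X₂ → Y → ℝ) (n M₁ M₂ : ℕ) (ε : ℝ) : Prop :=
  ∃ (c : Code X₁ X₂ Y M₁ M₂ n) (e : Fin M₁ → Fin M₂ → ℝ),
    (∀ (d : Delay dmin dmax) (fill : ℤ → X₁) (m₁ : Fin M₁) (m₂ : Fin M₂),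
      ∑ y, blockProb W d.1 fill (c.enc₁ m₁) (c.enc₂ (c.enc₁ m₁) m₂) y *
        ind (c.dec y ≠ (m₁, m₂)) ≤ e m₁ m₂) ∧
    ∑ m₁, ∑ m₂, e m₁ m₂ ≤ (M₁ : ℝ) * M₂ * ε

lemma blockProb_nonneg (hW : ∀ x₁ x₂, W x₁ x₂ ∈ stdSimplex ℝ Y) (d : ℤ) {n : ℕ} (fill : ℤ → X₁)
    (x₁ : Fin n → X₁) (x₂ : Fin n → X₂) (y : Fin n → Y) : 0 ≤ blockProb W d fill x₁ x₂ y :=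
  Finset.prod_nonneg fun _ _ => (hW _ _).1 _

lemma sum_blockProb (hW : ∀ x₁ x₂, W x₁ x₂ ∈ stdSimplex ℝ Y) (d : ℤ) {n : ℕ} (fill : ℤ → X₁)
    (x₁ : Fin n → X₁) (x₂ : Fin n → X₂) : ∑ y, blockProb W d fill x₁ x₂ y = 1 :=
  (prod_mem_stdSimplex fun i => hW (delayed x₁ fill d i) (x₂ i)).2

lemma sum_blockProb_comp (hW : ∀ x₁ x₂, W x₁ x₂ ∈ stdSimplex ℝ Y) (d : ℤ) {n k : ℕ}
    (fill : ℤ → X₁) (x₁ : Fin n → X₁) (x₂ : Fin n → X₂) {σ : Fin k → Fin n}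
    (hσ : Function.Injective σ) (F : (Fin k → Y) → ℝ) :
    ∑ y, blockProb W d fill x₁ x₂ y * F (y ∘ σ) =
      ∑ y : Fin k → Y, (∏ i, W (delayed x₁ fill d (σ i)) (x₂ (σ i)) (y i)) * F y :=
  piSum_comp_injective (p := fun i => W (delayed x₁ fill d i) (x₂ i)) (fun _ => (hW _ _).2) hσ F

lemma hasCode_one [Nonempty X₁] [Nonempty X₂] (hW : ∀ x₁ x₂, W x₁ x₂ ∈ stdSimplex ℝ Y)
    (n : ℕ) {M₁ M₂ : ℕ} (hM₁ : 0 < M₁) (hM₂ : 0 < M₂) : HasCode dmin dmax W n M₁ M₂ 1 := by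
  refine ⟨⟨fun _ _ => Classical.arbitrary X₁, fun _ _ _ => Classical.arbitrary X₂,
    fun _ => (⟨0, hM₁⟩, ⟨0, hM₂⟩)⟩, fun _ _ => 1, fun d fill m₁ m₂ => ?_, ?_⟩
  · refine le_of_le_of_eq (Finset.sum_le_sum fun y _ => ?_) (sum_blockProb hW d.1 fill
      (fun _ : Fin n => Classical.arbitrary X₁) fun _ => Classical.arbitrary X₂)
    exact mul_le_of_le_one_right (blockProb_nonneg hW _ _ _ _ _) (ind_le_one _)
  · simp

/-- A decoder that ignores the outputs near the ends of the block is not affected by the symbols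
outside the block. -/
lemma hasCode_of_interior_code [Nonempty X₂] (hW : ∀ x₁ x₂, W x₁ x₂ ∈ stdSimplex ℝ Y)
    {N M₁ M₂ : ℕ} {ε : ℝ} (C₁ : Fin M₁ → Fin (N + (dmin + dmax)) → X₁)
    (C₂ : (Fin (N + (dmin + dmax)) → X₁) → Fin M₂ → Fin N → X₂)
    (dec : (Fin N → Y) → Fin M₁ × Fin M₂)
    (h : ∑ m₁, ∑ m₂, ∑ d : Delay dmin dmax, ∑ t : Fin N → Y,
        (∏ i, W (window (C₁ m₁) i d.slot) (C₂ (C₁ m₁) m₂ i) (t i)) * ind (dec t ≠ (m₁, m₂)) ≤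
      (M₁ : ℝ) * M₂ * ε) :
    HasCode dmin dmax W (N + (dmin + dmax)) M₁ M₂ ε := by
  -- At time `i + dmax` the channel sees symbol `i + dmax - d` of user 1, which is entry `d.slot` of
  -- window `i` and lies in the block for every delay. Only these times are decoded; user 2 sends a
  -- dummy symbol at the others.
  set σ : Fin N → Fin (N + (dmin + dmax)) := fun i => ⟨i + dmax, by omega⟩ with hσ
  have hinj : Function.Injective σ := by
    intro a b hab
    simp only [hσ, Fin.mk.injEq] at hab
    exact Fin.ext (by omega)
  refine ⟨⟨C₁, fun x m t => if ht : dmax ≤ (t : ℕ) ∧ (t : ℕ) < N + dmax then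
      C₂ x m ⟨t - dmax, by omega⟩ else Classical.arbitrary X₂, fun y => dec (y ∘ σ)⟩,
    fun m₁ m₂ => ∑ d : Delay dmin dmax, ∑ t : Fin N → Y,
        (∏ i, W (window (C₁ m₁) i d.slot) (C₂ (C₁ m₁) m₂ i) (t i)) * ind (dec t ≠ (m₁, m₂)),
    fun d fill m₁ m₂ => ?_, h⟩
  rw [sum_blockProb_comp hW d.1 fill _ _ hinj fun t => ind (dec t ≠ (m₁, m₂))]
  refine le_of_eq_of_le ?_ (Finset.single_le_sum (f := fun d : Delay dmin dmax =>
    ∑ t : Fin N → Y, (∏ i, W (window (C₁ m₁) i d.slot) (C₂ (C₁ m₁) m₂ i) (t i)) *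
      ind (dec t ≠ (m₁, m₂))) (fun d _ => Finset.sum_nonneg fun t _ =>
        mul_nonneg (Finset.prod_nonneg fun i _ => (hW _ _).1 _) (ind_nonneg _))
    (Finset.mem_univ d))
  refine Finset.sum_congr rfl fun t _ => ?_
  congr 1
  refine Finset.prod_congr rfl fun i _ => ?_
  have hd := d.2
  have e1 : delayed (C₁ m₁) fill d.1 (σ i) = window (C₁ m₁) i d.slot := by
    have hi : 0 ≤ (((σ i : Fin _) : ℕ) : ℤ) - d.1 ∧
        (((σ i : Fin _) : ℕ) : ℤ) - d.1 < ((N + (dmin + dmax) : ℕ) : ℤ) := by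
      simp only [hσ]
      push_cast
      omega
    unfold delayed window
    rw [dif_pos hi]
    congr 1
    simp only [hσ, Delay.slot, Fin.mk.injEq]
    push_cast
    omega
  have e2 : dmax ≤ ((σ i : Fin _) : ℕ) ∧ ((σ i : Fin _) : ℕ) < N + dmax := by
    simp only [hσ]
    omega
  rw [e1]
  dsimp only
  rw [dif_pos e2]
  have e3 : (⟨(σ i : ℕ) - dmax, by omega⟩ : Fin N) = i := Fin.ext (by simp [hσ])
  rw [e3]

lemma HasCode.mono {n M₁ M₂ : ℕ} {ε ε' : ℝ} (h : HasCode dmin dmax W n M₁ M₂ ε) (hε : ε ≤ ε') :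
    HasCode dmin dmax W n M₁ M₂ ε' := by
  obtain ⟨c, e, h1, h2⟩ := h
  exact ⟨c, e, h1, h2.trans (mul_le_mul_of_nonneg_left hε (by positivity))⟩

/-- The message sets of a code can be reduced without increasing its error. -/
lemma HasCode.shrink (hW : ∀ x₁ x₂, W x₁ x₂ ∈ stdSimplex ℝ Y) {n M₁ M₂ L₁ L₂ : ℕ} {ε : ℝ}
    (h : HasCode dmin dmax W n M₁ M₂ ε) (hL₁ : 0 < L₁) (hL₂ : 0 < L₂) (h₁ : L₁ ≤ M₁)
    (h₂ : L₂ ≤ M₂) : HasCode dmin dmax W n L₁ L₂ ε := by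
  obtain ⟨c, e, he, hsum⟩ := h
  have : NeZero M₁ := ⟨by omega⟩
  have : NeZero M₂ := ⟨by omega⟩
  have : NeZero L₁ := ⟨by omega⟩
  have : NeZero L₂ := ⟨by omega⟩
  -- Averaged over all cyclic shifts, an `L₁ × L₂` rectangle of message pairs has the mean error of
  -- the full code, so some shift does at least as well.
  obtain ⟨s, -, hs⟩ : ∃ s ∈ (Finset.univ : Finset (Fin M₁ × Fin M₂)),
      ∑ a : Fin L₁, ∑ b : Fin L₂, e (Fin.castLE h₁ a + s.1) (Fin.castLE h₂ b + s.2) ≤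
        (L₁ : ℝ) * L₂ * ε := by
    refine Finset.exists_le_of_sum_le Finset.univ_nonempty ?_
    have hrot : ∀ a b, ∑ s : Fin M₁ × Fin M₂, e (a + s.1) (b + s.2) = ∑ m₁, ∑ m₂, e m₁ m₂ := by
      intro a b
      rw [Fintype.sum_prod_type]
      rw [← Equiv.sum_comp (Equiv.addLeft a) (fun m₁ => ∑ m₂, e m₁ m₂)]
      refine Finset.sum_congr rfl fun s₁ _ => ?_
      exact Equiv.sum_comp (Equiv.addLeft b) (fun m₂ => e (a + s₁) m₂)
    calc _ = ∑ a : Fin L₁, ∑ b : Fin L₂, ∑ s : Fin M₁ × Fin M₂,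
          e (Fin.castLE h₁ a + s.1) (Fin.castLE h₂ b + s.2) := by
          rw [Finset.sum_comm]
          exact Finset.sum_congr rfl fun a _ => Finset.sum_comm
      _ = (L₁ : ℝ) * L₂ * ∑ m₁, ∑ m₂, e m₁ m₂ := by
          simp only [hrot]
          simp [mul_assoc]
      _ ≤ (L₁ : ℝ) * L₂ * ((M₁ : ℝ) * M₂ * ε) :=
          mul_le_mul_of_nonneg_left hsum (by positivity)
      _ = _ := by
          simp
          ring
  set φ₁ : Fin L₁ → Fin M₁ := fun a => Fin.castLE h₁ a + s.1 with hφ₁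
  set φ₂ : Fin L₂ → Fin M₂ := fun b => Fin.castLE h₂ b + s.2 with hφ₂
  have i₁ : Function.Injective φ₁ := fun a b hab =>
    Fin.castLE_injective h₁ (add_right_cancel hab)
  have i₂ : Function.Injective φ₂ := fun a b hab =>
    Fin.castLE_injective h₂ (add_right_cancel hab)
  refine ⟨⟨fun a => c.enc₁ (φ₁ a), fun x b => c.enc₂ x (φ₂ b), fun y =>
    (Function.invFun φ₁ (c.dec y).1, Function.invFun φ₂ (c.dec y).2)⟩,
    fun a b => e (φ₁ a) (φ₂ b), fun d fill a b => ?_, hs⟩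
  refine le_trans (Finset.sum_le_sum fun y _ => ?_) (he d fill (φ₁ a) (φ₂ b))
  refine mul_le_mul_of_nonneg_left (ind_mono fun hne heq => hne ?_)
    (blockProb_nonneg hW _ _ _ _ _)
  dsimp only
  rw [heq]
  exact Prod.ext (Function.leftInverse_invFun i₁ a) (Function.leftInverse_invFun i₂ b)

/-- The bi-infinite sequence that continues the block `x` by the symbols `fill`. -/
def extend {n : ℕ} (x : Fin n → X₁) (fill : ℤ → X₁) (j : ℤ) : X₁ :=
  if h : 0 ≤ j ∧ j < n then x ⟨j.toNat, by omega⟩ else fill j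

/-- For the first block, the exterior consists of the second block and the true exterior, merged by
`extend`. -/
lemma delayed_castAdd {n k : ℕ} (x : Fin (n + k) → X₁) (fill : ℤ → X₁) (d : ℤ) (i : Fin n) :
    delayed x fill d (Fin.castAdd k i) =
      delayed (fun i => x (Fin.castAdd k i)) (extend x fill) d i := by
  unfold delayed extend
  simp only [Fin.val_castAdd]
  by_cases h : 0 ≤ (i : ℤ) - d ∧ (i : ℤ) - d < n
  · rw [dif_pos h, dif_pos ⟨h.1, by push_cast; omega⟩]
    rfl
  · rw [dif_neg h]

lemma delayed_natAdd {n k : ℕ} (x : Fin (n + k) → X₁) (fill : ℤ → X₁) (d : ℤ) (i : Fin k) :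
    delayed x fill d (Fin.natAdd n i) =
      delayed (fun i => x (Fin.natAdd n i)) (fun j => extend x fill (n + j)) d i := by
  unfold delayed extend
  have e : (((Fin.natAdd n i : Fin (n + k)) : ℕ) : ℤ) - d = n + ((i : ℤ) - d) := by
    simp only [Fin.val_natAdd]
    push_cast
    ring
  simp only [e]
  by_cases h : 0 ≤ (i : ℤ) - d ∧ (i : ℤ) - d < k
  · rw [dif_pos h, dif_pos ⟨by omega, by push_cast; omega⟩]
    congr 1
    ext
    simp only [Fin.val_natAdd]
    omega
  · rw [dif_neg h]

/-- Concatenation of codes. Each of the two blocks treats the other one as symbols outside. -/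
lemma HasCode.append (hW : ∀ x₁ x₂, W x₁ x₂ ∈ stdSimplex ℝ Y) {n k M₁ M₂ L₁ L₂ : ℕ} {ε ε' : ℝ}
    (h : HasCode dmin dmax W n M₁ M₂ ε) (h' : HasCode dmin dmax W k L₁ L₂ ε') :
    HasCode dmin dmax W (n + k) (M₁ * L₁) (M₂ * L₂) (ε + ε') := by
  obtain ⟨c, e, he, hsum⟩ := h
  obtain ⟨c', e', he', hsum'⟩ := h'
  let φ₁ : Fin M₁ × Fin L₁ ≃ Fin (M₁ * L₁) := finProdFinEquiv
  let φ₂ : Fin M₂ × Fin L₂ ≃ Fin (M₂ * L₂) := finProdFinEquiv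
  refine ⟨⟨fun m => Fin.append (c.enc₁ (φ₁.symm m).1) (c'.enc₁ (φ₁.symm m).2),
    fun x m => Fin.append (c.enc₂ (fun i => x (Fin.castAdd k i)) (φ₂.symm m).1)
      (c'.enc₂ (fun i => x (Fin.natAdd n i)) (φ₂.symm m).2),
    fun y => (φ₁ ((c.dec (y ∘ Fin.castAdd k)).1, (c'.dec (y ∘ Fin.natAdd n)).1),
      φ₂ ((c.dec (y ∘ Fin.castAdd k)).2, (c'.dec (y ∘ Fin.natAdd n)).2))⟩,
    fun m₁ m₂ => e (φ₁.symm m₁).1 (φ₂.symm m₂).1 + e' (φ₁.symm m₁).2 (φ₂.symm m₂).2,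
    fun d fill m₁ m₂ => ?_, ?_⟩
  · obtain ⟨⟨a, a'⟩, rfl⟩ := φ₁.surjective m₁
    obtain ⟨⟨b, b'⟩, rfl⟩ := φ₂.surjective m₂
    simp only [Equiv.symm_apply_apply, Fin.append_left, Fin.append_right]
    set x := Fin.append (c.enc₁ a) (c'.enc₁ a') with hx
    set u := Fin.append (c.enc₂ (c.enc₁ a) b) (c'.enc₂ (c'.enc₁ a') b') with hu
    have hl : ∑ y, blockProb W d.1 fill x u y * ind (c.dec (y ∘ Fin.castAdd k) ≠ (a, b)) ≤
        e a b := by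
      rw [sum_blockProb_comp hW d.1 fill x u (Fin.castAdd_injective n k)
        fun y => ind (c.dec y ≠ (a, b))]
      refine le_of_eq_of_le ?_ (he d (extend x fill) a b)
      simp only [delayed_castAdd, blockProb, hx, hu, Fin.append_left]
    have hr : ∑ y, blockProb W d.1 fill x u y * ind (c'.dec (y ∘ Fin.natAdd n) ≠ (a', b')) ≤
        e' a' b' := by
      rw [sum_blockProb_comp hW d.1 fill x u (Fin.natAdd_injective k n)
        fun y => ind (c'.dec y ≠ (a', b'))]
      refine le_of_eq_of_le ?_ (he' d (fun j => extend x fill (n + j)) a' b')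
      simp only [delayed_natAdd, blockProb, hx, hu, Fin.append_right]
    refine le_trans ?_ (add_le_add hl hr)
    rw [← Finset.sum_add_distrib]
    refine Finset.sum_le_sum fun y _ => ?_
    rw [← mul_add]
    refine mul_le_mul_of_nonneg_left ?_ (blockProb_nonneg hW _ _ _ _ _)
    have n1 := ind_nonneg (c.dec (y ∘ Fin.castAdd k) ≠ (a, b))
    have n2 := ind_nonneg (c'.dec (y ∘ Fin.natAdd n) ≠ (a', b'))
    by_cases h1 : c.dec (y ∘ Fin.castAdd k) = (a, b)
    · by_cases h2 : c'.dec (y ∘ Fin.natAdd n) = (a', b')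
      · rw [ind_of_false]
        · exact add_nonneg n1 n2
        · rw [h1, h2, not_not]
      · rw [ind_of_true h2]
        exact (ind_le_one _).trans (le_add_of_nonneg_left n1)
    · rw [ind_of_true h1]
      exact (ind_le_one _).trans (le_add_of_nonneg_right n2)
  · rw [← φ₁.sum_comp]
    have h3 : ∀ p : Fin M₁ × Fin L₁, ∑ m₂, (e (φ₁.symm (φ₁ p)).1 (φ₂.symm m₂).1 +
        e' (φ₁.symm (φ₁ p)).2 (φ₂.symm m₂).2) =
        L₂ * ∑ m₂, e p.1 m₂ + M₂ * ∑ m₂, e' p.2 m₂ := by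
      intro p
      rw [← φ₂.sum_comp]
      simp only [Equiv.symm_apply_apply, Fintype.sum_prod_type, Finset.sum_add_distrib,
        Finset.sum_const, Finset.card_univ, Fintype.card_fin, nsmul_eq_mul, Finset.mul_sum]
    simp only [h3, Fintype.sum_prod_type, Finset.sum_add_distrib, Finset.sum_const,
      Finset.card_univ, Fintype.card_fin, nsmul_eq_mul, ← Finset.mul_sum]
    push_cast
    nlinarith [mul_le_mul_of_nonneg_left hsum (show (0 : ℝ) ≤ L₁ * L₂ by positivity),
      mul_le_mul_of_nonneg_left hsum' (show (0 : ℝ) ≤ M₁ * M₂ by positivity)]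

lemma HasCode.exists_errorProb_le {n M₁ M₂ : ℕ} {ε : ℝ} (hM₁ : 0 < M₁) (hM₂ : 0 < M₂)
    (h : HasCode dmin dmax W n M₁ M₂ ε) :
    ∃ c : Code X₁ X₂ Y M₁ M₂ n, ∀ (d : Delay dmin dmax) (fill : Fin M₁ → Fin M₂ → ℤ → X₁),
      c.errorProb W d.1 fill ≤ ε := by
  obtain ⟨c, e, he, hsum⟩ := h
  refine ⟨c, fun d fill => ?_⟩
  have h1 : (0 : ℝ) < M₁ := by exact_mod_cast hM₁
  have h2 : (0 : ℝ) < M₂ := by exact_mod_cast hM₂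
  have h3 : ∑ m₁, ∑ m₂, ∑ y with c.dec y ≠ (m₁, m₂),
      blockProb W d.1 (fill m₁ m₂) (c.enc₁ m₁) (c.enc₂ (c.enc₁ m₁) m₂) y ≤
      (M₁ : ℝ) * M₂ * ε := by
    refine le_trans (Finset.sum_le_sum fun m₁ _ => Finset.sum_le_sum fun m₂ _ => ?_) hsum
    refine le_of_eq_of_le ?_ (he d (fill m₁ m₂) m₁ m₂)
    rw [Finset.sum_filter]
    refine Finset.sum_congr rfl fun y _ => ?_
    split_ifs with hy
    · rw [ind_of_true hy, mul_one]
    · rw [ind_of_false hy, mul_zero]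
  unfold Code.errorProb
  rw [one_div, inv_mul_le_iff₀ (by positivity)]
  exact h3

end HasCode

/-! ### From codes to rate regions -/

section Region

open Filter Topology

variable {X₁ X₂ Y : Type*} [Fintype X₁] [Fintype X₂] [Fintype Y] {dmin dmax : ℕ}
  {W : X₁ → X₂ → Y → ℝ}

/-- The pairs of rates that codes of all large lengths approach with vanishing error. -/
def approachable (dmin dmax : ℕ) (W : X₁ → X₂ → Y → ℝ) : Set (ℝ × ℝ) :=
  {R | 0 ≤ R.1 ∧ 0 ≤ R.2 ∧ ∀ ε > 0, ∀ η > 0, ∀ᶠ n : ℕ in atTop, ∃ M₁ M₂ : ℕ,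
    (2 : ℝ) ^ (n * (R.1 - η)) ≤ M₁ ∧ (2 : ℝ) ^ (n * (R.2 - η)) ≤ M₂ ∧
      HasCode dmin dmax W n M₁ M₂ ε}

/-- Rounding shortens the first block by at most one symbol, that is `r` bits, which half of the
slack `η` absorbs. -/
lemma rpow_le_mul_of_split {a b η r s : ℝ} {n p q M L : ℕ} (hpq : p + q = n) (hr : 0 ≤ r)
    (hs : 0 ≤ s) (hp : a * n - 1 ≤ p) (hq : b * n ≤ q) (hn : r ≤ n * (η / 2))
    (hM : (2 : ℝ) ^ (p * (r - η / 2)) ≤ M) (hL : (2 : ℝ) ^ (q * (s - η / 2)) ≤ L) :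
    (2 : ℝ) ^ (n * (a * r + b * s - η)) ≤ ((M * L : ℕ) : ℝ) := by
  have hpq' : (p : ℝ) + q = n := by exact_mod_cast hpq
  push_cast
  calc (2 : ℝ) ^ (n * (a * r + b * s - η)) ≤ 2 ^ (p * (r - η / 2) + q * (s - η / 2)) := by
        refine Real.rpow_le_rpow_of_exponent_le (by norm_num) ?_
        have e : (p : ℝ) * (r - η / 2) + q * (s - η / 2) = p * r + q * s - n * (η / 2) := by
          rw [← hpq']; ring
        rw [e]
        nlinarith [mul_le_mul_of_nonneg_right hp hr, mul_le_mul_of_nonneg_right hq hs]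
    _ = 2 ^ (p * (r - η / 2)) * 2 ^ (q * (s - η / 2)) := Real.rpow_add (by norm_num) _ _
    _ ≤ M * L := mul_le_mul hM hL (by positivity) (by positivity)

/-- Time sharing. -/
lemma convex_approachable (hW : ∀ x₁ x₂, W x₁ x₂ ∈ stdSimplex ℝ Y) :
    Convex ℝ (approachable dmin dmax W) := by
  rw [convex_iff_forall_pos]
  rintro R ⟨hR1, hR2, hR⟩ S ⟨hS1, hS2, hS⟩ a b ha hb hab
  refine ⟨?_, ?_, fun ε hε η hη => ?_⟩
  · simp only [Prod.fst_add, Prod.smul_fst, smul_eq_mul]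
    positivity
  · simp only [Prod.snd_add, Prod.smul_snd, smul_eq_mul]
    positivity
  have hfl : ∀ t : ℝ, 0 < t → Tendsto (fun n : ℕ => ⌊t * n⌋₊) atTop atTop := fun t ht =>
    tendsto_nat_floor_atTop.comp (tendsto_natCast_atTop_atTop.const_mul_atTop ht)
  have hsum : ∀ n : ℕ, ⌊b * n⌋₊ ≤ n - ⌊a * n⌋₊ := by
    intro n
    have h1 : (⌊a * n⌋₊ : ℝ) ≤ a * n := Nat.floor_le (by positivity)
    have h2 : (⌊b * n⌋₊ : ℝ) ≤ b * n := Nat.floor_le (by positivity)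
    have h3 : a * (n : ℝ) + b * n = n := by rw [← add_mul, hab, one_mul]
    have h4 : ⌊a * n⌋₊ + ⌊b * n⌋₊ ≤ n := by
      have : ((⌊a * n⌋₊ + ⌊b * n⌋₊ : ℕ) : ℝ) ≤ n := by push_cast; linarith
      exact_mod_cast this
    omega
  have hA := (hfl a ha).eventually (hR (ε / 2) (by positivity) (η / 2) (by positivity))
  have hB := (tendsto_atTop_mono hsum (hfl b hb)).eventually
    (hS (ε / 2) (by positivity) (η / 2) (by positivity))
  have hlin : Tendsto (fun n : ℕ => (n : ℝ) * (η / 2)) atTop atTop :=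
    tendsto_natCast_atTop_atTop.atTop_mul_const (by positivity)
  filter_upwards [hA, hB, hlin.eventually_ge_atTop R.1, hlin.eventually_ge_atTop R.2]
    with n ⟨M₁, M₂, hM₁, hM₂, hc⟩ ⟨L₁, L₂, hL₁, hL₂, hc'⟩ hn1 hn2
  have hle : ⌊a * n⌋₊ ≤ n := by
    have h1 : (⌊a * n⌋₊ : ℝ) ≤ n := (Nat.floor_le (by positivity)).trans
      (mul_le_of_le_one_left (by positivity) (by linarith))
    exact_mod_cast h1
  have hpq : ⌊a * n⌋₊ + (n - ⌊a * n⌋₊) = n := by omega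
  have hp : a * n - 1 ≤ ⌊a * n⌋₊ := (Nat.sub_one_lt_floor _).le
  have hq : b * n ≤ ((n - ⌊a * n⌋₊ : ℕ) : ℝ) := by
    rw [Nat.cast_sub hle]
    have h1 : (⌊a * n⌋₊ : ℝ) ≤ a * n := Nat.floor_le (by positivity)
    have h3 : a * (n : ℝ) + b * n = n := by rw [← add_mul, hab, one_mul]
    linarith
  refine ⟨M₁ * L₁, M₂ * L₂, ?_, ?_, ?_⟩
  · exact rpow_le_mul_of_split hpq hR1 hS1 hp hq hn1 hM₁ hL₁
  · exact rpow_le_mul_of_split hpq hR2 hS2 hp hq hn2 hM₂ hL₂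
  · have h := HasCode.append hW hc hc'
    rwa [hpq, add_halves] at h

lemma natCeil_sub_one_le {x : ℝ} (hx : 0 ≤ x) : (⌈x⌉₊ : ℝ) - 1 ≤ x := by
  linarith [Nat.ceil_lt_add_one hx]

/-- The message count refers to length `N + c` and the threshold to `N`; the `c` extra symbols cost
the constant `2 ^ (c * r)`. Subtracting 1 matters when `r < η`: the ceiling then stays at least 1
while the power tends to 0. -/
lemma natCeil_rpow_sub_one_mul_le {r s η : ℝ} {N c : ℕ} (hη : 0 < η) (hs : r ≤ s) :
    ((⌈(2 : ℝ) ^ (((N + c : ℕ) : ℝ) * (r - η))⌉₊ : ℝ) - 1) * 2 ^ (-(N * (s - η / 2))) ≤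
      2 ^ (c * r) * 2 ^ (-(N * (η / 2))) := by
  calc _ ≤ (2 : ℝ) ^ (((N + c : ℕ) : ℝ) * (r - η)) * 2 ^ (-(N * (s - η / 2))) :=
        mul_le_mul_of_nonneg_right (natCeil_sub_one_le (by positivity)) (by positivity)
    _ = 2 ^ (((N + c : ℕ) : ℝ) * (r - η) + -(N * (s - η / 2))) :=
        (Real.rpow_add (by norm_num) _ _).symm
    _ ≤ 2 ^ (c * r + -(N * (η / 2))) := by
        refine Real.rpow_le_rpow_of_exponent_le (by norm_num) ?_
        push_cast
        have h1 : 0 ≤ (N : ℝ) * (s - r) := mul_nonneg (by positivity) (by linarith)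
        have h2 : 0 ≤ (c : ℝ) * η := by positivity
        nlinarith
    _ = _ := Real.rpow_add (by norm_num) _ _

lemma innerRegion_subset_approachable (hW : ∀ x₁ x₂, W x₁ x₂ ∈ stdSimplex ℝ Y)
    [Nonempty X₂] : innerRegion dmin dmax W ⊆ approachable dmin dmax W := by
  rintro R ⟨hR1, hR2, P, hP, K, hK, h₁, h₂, h₁₂⟩
  refine ⟨hR1, hR2, fun ε hε η hη => ?_⟩
  obtain ⟨C, hC0, hC⟩ := exists_interior_code hW hP hK h₁ h₂ h₁₂
  set c := dmin + dmax with hc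
  -- The last two terms come from splitting `(M₁ - 1) * M₂` as `(M₁ - 1) + (M₁ - 1) * (M₂ - 1)`, so
  -- that each ceiling appears reduced by 1.
  set B : ℝ := 2 ^ (c * R.2) + 2 ^ (c * R.1) + (2 ^ (c * R.1) + 2 ^ (c * (R.1 + R.2))) with hB
  have hlim : Tendsto (fun N : ℕ => C * (((N : ℝ) * (η / 2) ^ 2)⁻¹ +
      B * 2 ^ (-(N * (η / 2))))) atTop (𝓝 0) := by
    have t1 : Tendsto (fun N : ℕ => ((N : ℝ) * (η / 2) ^ 2)⁻¹) atTop (𝓝 0) :=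
      (tendsto_natCast_atTop_atTop.atTop_mul_const (by positivity)).inv_tendsto_atTop
    have t2 : Tendsto (fun N : ℕ => (2 : ℝ) ^ (-((N : ℝ) * (η / 2)))) atTop (𝓝 0) := by
      have t3 : Tendsto (fun N : ℕ => (2 : ℝ) ^ ((N : ℝ) * (η / 2))) atTop atTop :=
        (tendsto_rpow_atTop_of_base_gt_one 2 (by norm_num)).comp
          (tendsto_natCast_atTop_atTop.atTop_mul_const (by positivity))
      refine t3.inv_tendsto_atTop.congr fun N => ?_
      exact (Real.rpow_neg (by norm_num) _).symm
    simpa using (t1.add (t2.const_mul B)).const_mul C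
  have hev := (hlim.eventually (gt_mem_nhds hε)).and (eventually_gt_atTop 0)
  have hsub := (tendsto_sub_atTop_nat c).eventually hev
  filter_upwards [hsub, eventually_ge_atTop c] with n ⟨hn, hN⟩ hnc
  obtain ⟨N, rfl⟩ := Nat.exists_eq_add_of_le' hnc
  rw [Nat.add_sub_cancel] at hn hN
  set M₁ := ⌈(2 : ℝ) ^ (((N + c : ℕ) : ℝ) * (R.1 - η))⌉₊ with hM₁
  set M₂ := ⌈(2 : ℝ) ^ (((N + c : ℕ) : ℝ) * (R.2 - η))⌉₊ with hM₂
  have p1 : 0 < M₁ := Nat.ceil_pos.2 (by positivity)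
  have p2 : 0 < M₂ := Nat.ceil_pos.2 (by positivity)
  refine ⟨M₁, M₂, Nat.le_ceil _, Nat.le_ceil _, ?_⟩
  obtain ⟨C₁, C₂, dec, h⟩ := hC N M₁ M₂ (η / 2) hN p1 p2 (by positivity)
  refine hasCode_of_interior_code hW C₁ C₂ dec (h.trans ?_)
  refine mul_le_mul_of_nonneg_left (le_trans ?_ hn.le) (by positivity)
  refine mul_le_mul_of_nonneg_left ?_ hC0
  have b1 := natCeil_rpow_sub_one_mul_le (N := N) (c := c) hη (le_refl R.1)
  have b2 := natCeil_rpow_sub_one_mul_le (N := N) (c := c) hη (le_refl R.2)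
  have b3 := natCeil_rpow_sub_one_mul_le (N := N) (c := c) hη (le_add_of_nonneg_right hR2 :
    R.1 ≤ R.1 + R.2)
  rw [← hM₁] at b1 b3
  rw [← hM₂] at b2
  have m1 : (0 : ℝ) ≤ (M₁ : ℝ) - 1 := by
    rw [sub_nonneg]; exact_mod_cast p1
  have b4 : ((M₁ : ℝ) - 1) * (M₂ - 1) * 2 ^ (-(N * (R.1 + R.2 - η / 2))) ≤
      2 ^ (c * (R.1 + R.2)) * 2 ^ (-(N * (η / 2))) := by
    calc _ ≤ (2 : ℝ) ^ (((N + c : ℕ) : ℝ) * (R.1 - η)) *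
          2 ^ (((N + c : ℕ) : ℝ) * (R.2 - η)) * 2 ^ (-(N * (R.1 + R.2 - η / 2))) := by
          refine mul_le_mul_of_nonneg_right ?_ (by positivity)
          exact mul_le_mul (natCeil_sub_one_le (by positivity)) (natCeil_sub_one_le (by positivity))
            (by rw [sub_nonneg]; exact_mod_cast p2) (by positivity)
      _ = 2 ^ (((N + c : ℕ) : ℝ) * (R.1 - η) + ((N + c : ℕ) : ℝ) * (R.2 - η) +
            -(N * (R.1 + R.2 - η / 2))) := by
          rw [Real.rpow_add (by norm_num), Real.rpow_add (by norm_num)]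
      _ ≤ 2 ^ (c * (R.1 + R.2) + -(N * (η / 2))) := by
          refine Real.rpow_le_rpow_of_exponent_le (by norm_num) ?_
          push_cast
          have h1 : 0 ≤ (N : ℝ) * η := by positivity
          have h2 : 0 ≤ (c : ℝ) * η := by positivity
          nlinarith
      _ = _ := Real.rpow_add (by norm_num) _ _
  have e : ((M₁ : ℝ) - 1) * M₂ * 2 ^ (-(N * (R.1 + R.2 - η / 2))) =
      ((M₁ : ℝ) - 1) * 2 ^ (-(N * (R.1 + R.2 - η / 2))) +
      ((M₁ : ℝ) - 1) * (M₂ - 1) * 2 ^ (-(N * (R.1 + R.2 - η / 2))) := by ring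
  rw [e, hB, add_mul, add_mul, add_mul]
  linarith

/-- One sequence of errors must serve all lengths: take the infimum of the attainable error levels
plus `1 / (n + 1)`, as the infimum need not be attained. The trivial code makes it meaningful for
every `n`. -/
lemma achievable_of_eventually [Nonempty X₁] [Nonempty X₂]
    (hW : ∀ x₁ x₂, W x₁ x₂ ∈ stdSimplex ℝ Y) {R : ℝ × ℝ} (hR1 : 0 ≤ R.1) (hR2 : 0 ≤ R.2)
    (h : ∀ ε > 0, ∀ᶠ n : ℕ in atTop,
      HasCode dmin dmax W n (numMessages n R.1) (numMessages n R.2) ε) :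
    Achievable dmin dmax W R := by
  have hpos : ∀ (n : ℕ) (r : ℝ), 0 < numMessages n r := fun n r => Nat.ceil_pos.2 (by positivity)
  let S : ℕ → Set ℝ := fun n =>
    {ε | 0 ≤ ε ∧ HasCode dmin dmax W n (numMessages n R.1) (numMessages n R.2) ε}
  have hS : ∀ n, (S n).Nonempty := fun n =>
    ⟨1, zero_le_one, hasCode_one hW n (hpos _ _) (hpos _ _)⟩
  have hb : ∀ n, BddBelow (S n) := fun n => ⟨0, fun ε hε => hε.1⟩
  refine ⟨hR1, hR2, fun n => sInf (S n) + 1 / ((n : ℝ) + 1), ?_, fun n => ?_⟩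
  · have h0 : Tendsto (fun n => sInf (S n)) atTop (𝓝 0) := by
      rw [Metric.tendsto_nhds]
      intro ε hε
      filter_upwards [h (ε / 2) (by positivity)] with n hn
      have h1 : sInf (S n) ≤ ε / 2 := csInf_le (hb n) ⟨by positivity, hn⟩
      have h2 : 0 ≤ sInf (S n) := le_csInf (hS n) fun ε hε => hε.1
      rw [Real.dist_eq, sub_zero, abs_of_nonneg h2]
      linarith
    simpa using h0.add tendsto_one_div_add_atTop_nhds_zero_nat
  · obtain ⟨ε, hε, hlt⟩ := exists_lt_of_csInf_lt (hS n)
      (lt_add_of_pos_right (sInf (S n)) (Nat.one_div_pos_of_nat (α := ℝ) (n := n)))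
    exact (hε.2.mono hlt.le).exists_errorProb_le (hpos _ _) (hpos _ _)

lemma exists_numMessages_le {r s : ℝ} (hr : 0 ≤ r) (hs : 0 < s) :
    ∃ η > 0, ∀ n M : ℕ, (2 : ℝ) ^ (n * (r - η)) ≤ M →
      numMessages n ((1 - s) * r) ≤ M := by
  rcases hr.eq_or_lt with rfl | hr
  -- At rate zero a single message is required, so any slack works.
  · refine ⟨1, one_pos, fun n M hM => ?_⟩
    have h1 : 0 < (M : ℝ) := lt_of_lt_of_le (by positivity) hM
    have h2 : 0 < M := by exact_mod_cast h1
    simp [numMessages]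
    omega
  · refine ⟨s * r, by positivity, fun n M hM => ?_⟩
    refine Nat.ceil_le.2 (le_of_eq_of_le ?_ hM)
    congr 1
    ring

lemma approachable_subset_capacityRegion [Nonempty X₁] [Nonempty X₂]
    (hW : ∀ x₁ x₂, W x₁ x₂ ∈ stdSimplex ℝ Y) :
    approachable dmin dmax W ⊆ capacityRegion dmin dmax W := by
  rintro R ⟨hR1, hR2, hR⟩
  -- Scaling by `1 - s`, unlike subtracting a constant, keeps zero rates at zero and all rates
  -- nonnegative.
  have hlim : Tendsto (fun s : ℝ => ((1 - s) * R.1, (1 - s) * R.2)) (𝓝[>] 0) (𝓝 R) := by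
    have hc : Continuous fun s : ℝ => ((1 - s) * R.1, (1 - s) * R.2) := by fun_prop
    have := hc.tendsto 0
    simp only [sub_zero, one_mul] at this
    exact this.mono_left nhdsWithin_le_nhds
  refine mem_closure_of_tendsto hlim ?_
  filter_upwards [Ioo_mem_nhdsGT (zero_lt_one' ℝ)] with s ⟨hs0, hs1⟩
  have h1s : 0 ≤ 1 - s := by linarith
  obtain ⟨η₁, hη₁, h₁⟩ := exists_numMessages_le hR1 hs0
  obtain ⟨η₂, hη₂, h₂⟩ := exists_numMessages_le hR2 hs0
  refine achievable_of_eventually hW (mul_nonneg h1s hR1) (mul_nonneg h1s hR2) fun ε hε => ?_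
  filter_upwards [hR ε hε (min η₁ η₂) (lt_min hη₁ hη₂)] with n ⟨M₁, M₂, hM₁, hM₂, hc⟩
  refine hc.shrink hW (Nat.ceil_pos.2 (by positivity)) (Nat.ceil_pos.2 (by positivity))
    (h₁ n M₁ (le_trans ?_ hM₁)) (h₂ n M₂ (le_trans ?_ hM₂))
  · refine Real.rpow_le_rpow_of_exponent_le (by norm_num)
      (mul_le_mul_of_nonneg_left ?_ (by positivity))
    linarith [min_le_left η₁ η₂]
  · refine Real.rpow_le_rpow_of_exponent_le (by norm_num)
      (mul_le_mul_of_nonneg_left ?_ (by positivity))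
    linarith [min_le_right η₁ η₂]

end Region

end ACCMAC

theorem mainTheorem5 {X₁ X₂ Y : Type*} [Fintype X₁] [Fintype X₂] [Fintype Y]
    (dmin dmax : ℕ) (W : X₁ → X₂ → Y → ℝ) (hW : ∀ x₁ x₂, W x₁ x₂ ∈ stdSimplex ℝ Y) :
    closure (convexHull ℝ (ACCMAC.innerRegion dmin dmax W)) ⊆
      ACCMAC.capacityRegion dmin dmax W := by
  rcases (ACCMAC.innerRegion dmin dmax W).eq_empty_or_nonempty with h | ⟨R, hR⟩
  · simp [h]
  obtain ⟨-, -, P, hP, K, hK, -⟩ := hR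
  -- `P` and `K v` have total mass one, so the alphabets are nonempty, as dummy symbols and the
  -- trivial code require.
  have h1 : Nonempty X₁ := by
    by_contra h
    rw [not_nonempty_iff] at h
    have := hP.2
    simp at this
  have h2 : Nonempty X₂ := by
    by_contra h
    rw [not_nonempty_iff] at h
    have := (hK fun _ => Classical.arbitrary X₁).2
    simp at this
  refine closure_minimal (convexHull_min (ACCMAC.innerRegion_subset_approachable hW)
    (ACCMAC.convex_approachable hW) |>.trans (ACCMAC.approachable_subset_capacityRegion hW))
    isClosed_closure
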